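/- **Setting.** A control flow graph $G$ consists of a finite set of locations, finitely many edges $(\ell,a,\ell')$ labelled by actions, an initial location and an exit location different from it. Every location is reachable from the initial location and can reach the exit location, and each action labels at most one edge. $\Sigma_G$ is the set of actions of $G$, and $\mathrm{traces}(G)$ is the set of label sequences of paths from the initial to the exit location. The interleavings of the synchronization-free parameterized program with thread template $G$ are the finite words $\tau$ of indexed actions $\langle a:i\rangle$, $i\in\mathbb N$, such that the sequence of actions of each thread $i$ in $\tau$ is empty or in $\mathrm{traces}(G)$. Let $I\subseteq\Sigma_G^2$ be a (not necessarily symmetric) commutativity relation. Write $\tau\sqsubseteq_I\tau'$ if $\tau'$ is obtained from $\tau$ by finitely many replacements of an adjacent pair $\langle a:i\rangle\langle b:j\rangle$, $i\ne j$, $(a,b)\in I$, by $\langle b:j\rangle\langle a:i\rangle$. $L_1$ is a Mazurkiewicz reduction of $L_2$ if $L_1\subseteq L_2$ and every $\tau\in L_2$ satisfies $\tau\sqsubseteq_I\tau'$ for some $\tau'\in L_1$. An atomic fusion $\mathcal F=(G',(\beta_1,G_{\beta_1}),\dots,(\beta_n,G_{\beta_n}))$ of $G$ consists of a control flow graph $G'$,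 distinct actions $\beta_k\in\Sigma_{G'}$ and control flow graphs $G_{\beta_k}$ with $\mathrm{traces}(G_{\beta_k})\neq\emptyset$ whose actions include no $\beta_j$, such that $G$ arises from $G'$ by inserting each $G_{\beta_k}$ in place of the edge $(\ell_k,\beta_k,\ell'_k)$: the initial and exit locations of $G_{\beta_k}$ are merged with $\ell_k$ and $\ell'_k$, and its other locations are fresh. So that this is a replacement of the edge, we require: if some edge of $G_{\beta_k}$ enters its initial location, then all edges of $G$ that leave $\ell_k$ stem from edges of $G_{\beta_k}$ leaving its initial location, and $\ell_k$ is not the exit of $G$; dually, if some edge of $G_{\beta_k}$ leaves its exit location, then all edges of $G$ that enter $\ell'_k$ stem from edges of $G_{\beta_k}$ entering its exit location, and $\ell'_k$ is not the initial location of $G$. $\mathcal F$ is *sound* with respect to $I$ if the set of words obtained from the interleavings of $G'$ by replacing each occurrence of each $\langle\beta_k:i\rangle$ by some trace of $G_{\beta_k}$, executed by thread $i$, is a Mazurkiewicz reduction of the set of interleavings of $G$. Let $\overline I=\Sigma_G^2\setminus I$. Write $a\lessdot b$ if some trace of $G$ has an infix that begins with $a$ and ends with $b$ (possibly the one-letter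 infix $a=b$); $(a,b)\in\mathsf{at}$ if some trace of some $G_{\beta_k}$ has the form $\rho\,b\,\iota\,a\,\sigma$; and let $\leadsto$ be the relation $({\lessdot}\cup\mathsf{at})\circ\bigl(\overline I\circ({\lessdot}\cup\mathsf{at})\bigr)^*$ (the inner part of ${\rightarrowtail}=\overline I\circ\bigl(({\lessdot}\cup\mathsf{at})\circ\overline I\bigr)^+=\overline I\circ{\leadsto}\circ\overline I$). **Algorithm.** Step 1: compute the graph $(\Sigma_G,\leadsto)$. Then, for each $\beta_k$: Step 2: compute the strongly connected components (SCCs) of the edges of $G_{\beta_k}$ (an edge may be followed by any edge that starts in its target location), with the reachability order $\preceq$ between SCCs. Step 3: for each $a\in\Sigma_G$ compute $\min(a)$, the set of $\preceq$-minimal elements among the SCCs that contain an edge labelled by some $b$ with $(b,a)\notin I$. Step 4: for each $a\in\Sigma_G$ compute $\max(a)$, the set of $\preceq$-maximal elements among the SCCs that contain an edge labelled by some $b$ with $(a,b)\notin I$. Step 5: check whether there are SCCs $S_1\preceq S_2$ of $G_{\beta_k}$, where $S_1$ is non-trivial (it has at least two elements, or its single element is a self-loop) in case $S_1=S_2$,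 and actions $a\leadsto b$ with $S_1\in\min(a)$ and $S_2\in\max(b)$. If such $S_1,S_2$ exist for some $\beta_k$, answer "unsound", otherwise "sound". **Theorem.** This algorithm decides soundness of atomic fusions of synchronization-free programs: for all $G$, $\mathcal F$, $I$ as above it answers "sound" if and only if $\mathcal F$ is sound with respect to $I$; equivalently, the witnesses of Step 5 exist for some $\beta_k$ if and only if $\mathcal F$ is not sound. It terminates in polynomial time: an implementation of the steps, in which each comparison of two actions, locations or constant-size tuples of them, each boolean connective and each list cell visited or built costs one step, takes at most $p(N)$ steps, where $p$ is a fixed polynomial and $N$ is the total size of $G$, $\mathcal F$ and $I$ (numbers of locations, edges, blocks and pairs). -/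

import Mathlib

namespace ParProg

/-! ## Control flow graphs and their traces -/

/-- A transition: source location, action, target location. -/
abbrev Edge (Loc Act : Type) : Type := Loc × Act × Loc

namespace Edge

variable {Loc Act : Type}

abbrev src (e : Edge Loc Act) : Loc := e.1
abbrev label (e : Edge Loc Act) : Act := e.2.1
abbrev tgt (e : Edge Loc Act) : Loc := e.2.2

end Edge

/-- `Run Δ ℓ τ ℓ'`: the transitions in `Δ` admit a path from `ℓ` to `ℓ'` labelled by `τ`. -/
inductive Run {Loc Act : Type} (Δ : List (Edge Loc Act)) : Loc → List Act → Loc → Prop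
  | nil (ℓ : Loc) : Run Δ ℓ [] ℓ
  | cons {ℓ ℓ₁ ℓ₂ : Loc} {a : Act} {τ : List Act} :
      (ℓ, a, ℓ₁) ∈ Δ → Run Δ ℓ₁ τ ℓ₂ → Run Δ ℓ (a :: τ) ℓ₂

/-- A control flow graph over the actions `Act` (no synchronization actions), in which every
location lies on a path from the initial to the exit location, and in which every action labels
at most one edge. The finite transition relation is given as a list, the input format of the
algorithm. -/
structure CFG (Loc Act : Type) where
  locs : Finset Loc
  edges : List (Edge Loc Act)
  init : Loc
  exit : Loc
  init_mem : init ∈ locs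
  exit_mem : exit ∈ locs
  init_ne_exit : init ≠ exit
  src_mem : ∀ e ∈ edges, e.src ∈ locs
  tgt_mem : ∀ e ∈ edges, e.tgt ∈ locs
  reachable : ∀ ℓ ∈ locs, ∃ τ, Run edges init τ ℓ
  coreachable : ∀ ℓ ∈ locs, ∃ τ, Run edges ℓ τ exit
  labels_nodup : (edges.map Edge.label).Nodup

namespace CFG

variable {Loc Act : Type}

/-- The set of actions occurring in `G`. -/
def alphabet (G : CFG Loc Act) : Set Act := {a | ∃ e ∈ G.edges, e.label = a}

/-- The labels of the paths from the initial to the exit location. -/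
def traces (G : CFG Loc Act) : Language Act := {τ | Run G.edges G.init τ G.exit}

/-- Number of locations and edges. -/
def size (G : CFG Loc Act) : ℕ := G.locs.card + G.edges.length

end CFG

/-! ## Interleavings, morphisms, Mazurkiewicz reductions -/

section Words

variable {Loc Act X Y : Type}

/-- The trace of the actions that the indexed trace `τ` attributes to thread `i`. -/
def localTrace (τ : List (Act × ℕ)) (i : ℕ) : List Act :=
  (τ.filter (fun x => x.2 = i)).map Prod.fst

/-- The interleavings of the parameterized program without synchronization whose thread template
is `G`: every thread runs from the initial to the exit location, or does not run at all. -/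
def interleavings (G : CFG Loc Act) : Language (Act × ℕ) :=
  {τ | ∀ i : ℕ, localTrace τ i ∈ G.traces ∨ localTrace τ i = []}

/-- Extension of `μ : X → 𝒫(Y*)` to languages over `X` (on words, by concatenation). -/
def extend (μ : X → Language Y) (L : Language X) : Language Y :=
  {v | ∃ w ∈ L, v ∈ (w.map μ).prod}

/-- The lifting of a morphism to indexed actions. -/
def liftIdx (μ : X → Language Y) : X × ℕ → Language (Y × ℕ) :=
  fun x => {v | ∃ τ ∈ μ x.1, v = τ.map (fun y => (y, x.2))}

/-- One swap of adjacent actions of different threads, in the direction that `I` permits. -/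
def Swap (I : List (Act × Act)) (τ τ' : List (Act × ℕ)) : Prop :=
  ∃ (ρ σ : List (Act × ℕ)) (a b : Act) (i j : ℕ), (a, b) ∈ I ∧ i ≠ j ∧
    τ = ρ ++ [(a, i), (b, j)] ++ σ ∧ τ' = ρ ++ [(b, j), (a, i)] ++ σ

/-- The covering preorder of the (semi-)commutativity relation `I`. -/
def CoveredBy (I : List (Act × Act)) : List (Act × ℕ) → List (Act × ℕ) → Prop :=
  Relation.ReflTransGen (Swap I)

/-- `L₁` is a Mazurkiewicz reduction of `L₂` up to `I`. -/
def IsMazurkiewiczReduction (I : List (Act × Act)) (L₁ L₂ : Language (Act × ℕ)) : Prop :=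
  (∀ τ ∈ L₁, τ ∈ L₂) ∧ ∀ τ ∈ L₂, ∃ τ' ∈ L₁, CoveredBy I τ τ'

end Words

/-! ## Atomic fusions -/

section Fusion

variable {Loc Act : Type}

open Classical in
/-- `G` arises from `G'` by inserting, for every `(β, B)` in `blocks`, the graph `B` in place of
the edge labelled `β`: the initial and exit location of `B` are merged with the source and target
of that edge, all other locations of `B` become fresh locations (`ρ β` renames the locations of
`B`).

Merging the end points amounts to replacing the edge by `B` only if a run that comes back to the
entry of `B` inside `B` cannot leave `B` there, and a run cannot get to edges that leave the exit
of `B` without passing through `B`. The clauses `reentry_init` and `reentry_exit` say this; they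
are void if no edge of `B` enters its initial location or leaves its exit location. -/
structure IsInsertion (G G' : CFG Loc Act) (blocks : List (Act × CFG Loc Act))
    (ρ : Act → Loc → Loc) : Prop where
  init_eq : G.init = G'.init
  exit_eq : G.exit = G'.exit
  entry : ∀ B ∈ blocks, ∀ e ∈ G'.edges, e.label = B.1 → ρ B.1 B.2.init = e.src
  leave : ∀ B ∈ blocks, ∀ e ∈ G'.edges, e.label = B.1 → ρ B.1 B.2.exit = e.tgt
  fresh : ∀ B ∈ blocks, ∀ ℓ ∈ B.2.locs, ℓ ≠ B.2.init → ℓ ≠ B.2.exit → ρ B.1 ℓ ∉ G'.locs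
  inj : ∀ B ∈ blocks, ∀ B' ∈ blocks, ∀ ℓ ∈ B.2.locs, ∀ ℓ' ∈ B'.2.locs,
    ℓ ≠ B.2.init → ℓ ≠ B.2.exit → ℓ' ≠ B'.2.init → ℓ' ≠ B'.2.exit →
    ρ B.1 ℓ = ρ B'.1 ℓ' → B.1 = B'.1 ∧ ℓ = ℓ'
  locs_iff : ∀ ℓ, ℓ ∈ G.locs ↔ ℓ ∈ G'.locs ∨ ∃ B ∈ blocks, ∃ ℓ' ∈ B.2.locs, ρ B.1 ℓ' = ℓ
  edges_perm : G.edges.Perm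
    (G'.edges.filter (fun e => e.label ∉ blocks.map Prod.fst) ++
      blocks.flatMap (fun B => B.2.edges.map (fun e => (ρ B.1 e.src, e.label, ρ B.1 e.tgt))))
  reentry_init : ∀ B ∈ blocks, (∃ f ∈ B.2.edges, f.tgt = B.2.init) →
    ρ B.1 B.2.init ≠ G.exit ∧
    ∀ e ∈ G.edges, e.src = ρ B.1 B.2.init →
      ∃ f ∈ B.2.edges, f.src = B.2.init ∧ f.label = e.label
  reentry_exit : ∀ B ∈ blocks, (∃ f ∈ B.2.edges, f.src = B.2.exit) →
    ρ B.1 B.2.exit ≠ G.init ∧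
    ∀ e ∈ G.edges, e.tgt = ρ B.1 B.2.exit →
      ∃ f ∈ B.2.edges, f.tgt = B.2.exit ∧ f.label = e.label

/-- An atomic fusion of the program with thread template `G`: a thread template `outer`, and a
list of block symbols `β` occurring in it, each with the body of the block. -/
structure AtomicFusion (G : CFG Loc Act) where
  outer : CFG Loc Act
  blocks : List (Act × CFG Loc Act)
  symbols_nodup : (blocks.map Prod.fst).Nodup
  symbols_mem : ∀ B ∈ blocks, B.1 ∈ outer.alphabet
  symbols_notMem : ∀ B ∈ blocks, ∀ B' ∈ blocks, B'.1 ∉ B.2.alphabet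
  traces_nonempty : ∀ B ∈ blocks, ∃ τ, τ ∈ B.2.traces
  insertion : ∃ ρ : Act → Loc → Loc, IsInsertion G outer blocks ρ

namespace AtomicFusion

variable {G : CFG Loc Act}

/-- The fusion morphism: block symbols are mapped to the traces of their body, all other actions
to themselves. -/
def morphism (F : AtomicFusion G) (a : Act) : Language Act :=
  {τ | (∃ B ∈ F.blocks, B.1 = a ∧ τ ∈ B.2.traces) ∨ ((∀ B ∈ F.blocks, B.1 ≠ a) ∧ τ = [a])}

/-- The fusion is sound with respect to the commutativity relation `I`. -/
def Sound (F : AtomicFusion G) (I : List (Act × Act)) : Prop :=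
  IsMazurkiewiczReduction I (extend (liftIdx F.morphism) (interleavings F.outer))
    (interleavings G)

end AtomicFusion

/-- Size of an input of the algorithm: a thread template, an atomic fusion of it, and the list of
the pairs in the commutativity relation. -/
def inputSize (G : CFG Loc Act) (F : AtomicFusion G) (I : List (Act × Act)) : ℕ :=
  G.size + F.outer.size + (F.blocks.map (fun B => B.2.size + 1)).sum + I.length

end Fusion

/-! ## What the algorithm computes

The relations, strongly connected components and extremal sets that the steps of the algorithm
compute, in terms of traces and paths. -/

section Spec

variable {Loc Act : Type}

/-- Program order: some trace of `G` has an infix that begins with `a` and ends with `b`. -/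
def ProgOrder (G : CFG Loc Act) (a b : Act) : Prop :=
  ∃ ρ ι σ : List Act, ρ ++ ι ++ σ ∈ G.traces ∧ ι.head? = some a ∧ ι.getLast? = some b

/-- Reverse program order inside the blocks. -/
def AtRel (blocks : List (Act × CFG Loc Act)) (a b : Act) : Prop :=
  ∃ B ∈ blocks, ∃ ρ ι σ : List Act, ρ ++ [b] ++ ι ++ [a] ++ σ ∈ B.2.traces

/-- The complement of `I`, as a relation on the actions of `G`. -/
def Dep (G : CFG Loc Act) (I : List (Act × Act)) (a b : Act) : Prop :=
  a ∈ G.alphabet ∧ b ∈ G.alphabet ∧ (a, b) ∉ I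

/-- Program order or reverse program order inside a block. -/
def Link (G : CFG Loc Act) (blocks : List (Act × CFG Loc Act)) (a b : Act) : Prop :=
  ProgOrder G a b ∨ AtRel blocks a b

/-- Dependence chains: the relation `Link ∘ (Dep ∘ Link)*`. -/
def Chain (G : CFG Loc Act) (blocks : List (Act × CFG Loc Act)) (I : List (Act × Act)) :
    Act → Act → Prop :=
  Relation.Comp (Link G blocks)
    (Relation.ReflTransGen (Relation.Comp (Dep G I) (Link G blocks)))

/-- Reachability between the edges of `B`: some path of `B` begins with `e` and ends with `f`
(possibly with `e = f` and a path of a single edge). -/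
def EdgeReach (B : CFG Loc Act) : Edge Loc Act → Edge Loc Act → Prop :=
  Relation.ReflTransGen (fun e f => e ∈ B.edges ∧ f ∈ B.edges ∧ e.tgt = f.src)

/-- `S` is a strongly connected component of the edges of `B`. -/
def IsSCC (B : CFG Loc Act) (S : Set (Edge Loc Act)) : Prop :=
  ∃ e ∈ B.edges, S = {f | f ∈ B.edges ∧ EdgeReach B e f ∧ EdgeReach B f e}

/-- Reachability between strongly connected components. -/
def SCCLe (B : CFG Loc Act) (S₁ S₂ : Set (Edge Loc Act)) : Prop :=
  ∃ e ∈ S₁, ∃ f ∈ S₂, EdgeReach B e f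

/-- A component is non-trivial if it has two elements, or if its only element has a self-loop,
that is, an edge that can follow itself. -/
def NontrivialSCC (S : Set (Edge Loc Act)) : Prop :=
  S.Nontrivial ∨ ∃ e, S = {e} ∧ e.tgt = e.src

/-- The minimal elements, with respect to `SCCLe`, among the components of `B` that contain an
edge labelled by some `b` with `(b, a) ∉ I`. -/
def minSCC (B : CFG Loc Act) (I : List (Act × Act)) (a : Act) : Set (Set (Edge Loc Act)) :=
  {S | (IsSCC B S ∧ ∃ e ∈ S, (e.label, a) ∉ I) ∧
    ∀ S', IsSCC B S' → (∃ e ∈ S', (e.label, a) ∉ I) → SCCLe B S' S → S' = S}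

/-- The maximal elements, with respect to `SCCLe`, among the components of `B` that contain an
edge labelled by some `b` with `(a, b) ∉ I`. -/
def maxSCC (B : CFG Loc Act) (I : List (Act × Act)) (a : Act) : Set (Set (Edge Loc Act)) :=
  {S | (IsSCC B S ∧ ∃ e ∈ S, (a, e.label) ∉ I) ∧
    ∀ S', IsSCC B S' → (∃ e ∈ S', (a, e.label) ∉ I) → SCCLe B S S' → S' = S}

/-- The body of some block has a pair of components that witnesses unsoundness. -/
def HasWitness (G : CFG Loc Act) (blocks : List (Act × CFG Loc Act)) (I : List (Act × Act)) :
    Prop :=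
  ∃ B ∈ blocks, ∃ S₁ S₂ : Set (Edge Loc Act), IsSCC B.2 S₁ ∧ IsSCC B.2 S₂ ∧
    SCCLe B.2 S₁ S₂ ∧ (S₁ = S₂ → NontrivialSCC S₁) ∧
    ∃ a ∈ G.alphabet, ∃ b ∈ G.alphabet,
      Chain G blocks I a b ∧ S₁ ∈ minSCC B.2 I a ∧ S₂ ∈ maxSCC B.2 I b

end Spec

/-! ## Computations with a step count

Unit-cost model: one step for each comparison of two identifiers (or constant-size tuples of
identifiers), for each boolean connective, and for each list cell that is visited or built. The
algorithm below touches its input and its intermediate lists only through these operations. -/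

/-- A result together with the number of elementary steps spent on it. -/
structure Counted (α : Type) where
  val : α
  steps : ℕ

namespace Counted

variable {α β : Type}

instance : Monad Counted where
  pure x := ⟨x, 0⟩
  bind m f := ⟨(f m.val).val, m.steps + (f m.val).steps⟩

/-- One elementary step. -/
def tick : Counted Unit := ⟨(), 1⟩

/-- Comparison of two identifiers, or of two constant-size tuples of identifiers. -/
def eqT [DecidableEq α] (x y : α) : Counted Bool := ⟨decide (x = y), 1⟩

def notT (p : Counted Bool) : Counted Bool := do
  tick
  let b ← p
  pure (!b)

def andT (p q : Counted Bool) : Counted Bool := do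
  tick
  let b ← p
  if b then q else pure false

def orT (p q : Counted Bool) : Counted Bool := do
  tick
  let b ← p
  if b then pure true else q

/-- Does some list element satisfy `p`? -/
def anyT (p : α → Counted Bool) : List α → Counted Bool
  | [] => do
    tick
    pure false
  | x :: xs => do
    tick
    let b ← p x
    if b then pure true else anyT p xs

def filterT (p : α → Counted Bool) : List α → Counted (List α)
  | [] => do
    tick
    pure []
  | x :: xs => do
    tick
    let b ← p x
    let r ← filterT p xs
    if b then pure (x :: r) else pure r

def mapT (f : α → Counted β) : List α → Counted (List β)
  | [] => do
    tick
    pure []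
  | x :: xs => do
    tick
    let y ← f x
    let r ← mapT f xs
    pure (y :: r)

def appendT : List α → List α → Counted (List α)
  | [], ys => do
    tick
    pure ys
  | x :: xs, ys => do
    tick
    let r ← appendT xs ys
    pure (x :: r)

/-- All pairs of an element of the first and an element of the second list. -/
def pairsT : List α → List β → Counted (List (α × β))
  | [], _ => do
    tick
    pure []
  | x :: xs, ys => do
    tick
    let r ← mapT (fun y => pure (x, y)) ys
    let s ← pairsT xs ys
    appendT r s

def memT [DecidableEq α] (x : α) (l : List α) : Counted Bool := anyT (fun y => eqT x y) l

/-- Warshall's algorithm: `P` lists all pairs, `R` the pairs found so far; every element of the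
third argument is used once as an intermediate point. -/
def warshallT [DecidableEq α] (P : List (α × α)) : List α → List (α × α) →
    Counted (List (α × α))
  | [], R => do
    tick
    pure R
  | w :: ws, R => do
    tick
    let R' ← filterT
      (fun xy => orT (memT xy R) (andT (memT (xy.1, w) R) (memT (w, xy.2) R))) P
    warshallT P ws R'

/-- The transitive closure of a relation on the elements of `V`. -/
def closureT [DecidableEq α] (V : List α) (r : α → α → Counted Bool) :
    Counted (List (α × α)) := do
  let P ← pairsT V V
  let R ← filterT (fun xy => r xy.1 xy.2) P
  warshallT P V R

end Counted

/-! ## The algorithm -/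

section Algorithm

open Counted

variable {Loc Act : Type} [DecidableEq Loc] [DecidableEq Act]

/-- The pairs `(e, f)` of edges such that a path of at least two edges begins with `e` and ends
with `f`. -/
def edgeClosureT (Δ : List (Edge Loc Act)) : Counted (List (Edge Loc Act × Edge Loc Act)) :=
  closureT Δ (fun e f => eqT e.tgt f.src)

/-- Reachability between edges; `C` is the result of `edgeClosureT`. -/
def reachT (C : List (Edge Loc Act × Edge Loc Act)) (e f : Edge Loc Act) : Counted Bool :=
  orT (eqT e f) (memT (e, f) C)

def depT (I : List (Act × Act)) (a b : Act) : Counted Bool := notT (memT (a, b) I)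

def progOrderT (Δ : List (Edge Loc Act)) (C : List (Edge Loc Act × Edge Loc Act)) (a b : Act) :
    Counted Bool :=
  anyT (fun e => andT (eqT e.label a)
    (anyT (fun f => andT (eqT f.label b) (reachT C e f)) Δ)) Δ

/-- Each block is given by the list of its edges and the result of `edgeClosureT`. -/
def atRelT (bodies : List (List (Edge Loc Act) × List (Edge Loc Act × Edge Loc Act)))
    (a b : Act) : Counted Bool :=
  anyT (fun B => anyT (fun e => andT (eqT e.label b)
    (anyT (fun f => andT (eqT f.label a) (memT (e, f) B.2)) B.1)) B.1) bodies

/-- Step 1: the actions of `G`, and the edges of the graph of dependence chains on them. -/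
def step1 (G : CFG Loc Act) (blocks : List (Act × CFG Loc Act)) (I : List (Act × Act)) :
    Counted (List Act × List (Act × Act)) := do
  let A ← mapT (fun e => pure e.label) G.edges
  let C ← edgeClosureT G.edges
  let bodies ← mapT (fun B => do
    let CB ← edgeClosureT B.2.edges
    pure (B.2.edges, CB)) blocks
  let P ← pairsT A A
  let R ← filterT (fun ab => orT (progOrderT G.edges C ab.1 ab.2) (atRelT bodies ab.1 ab.2)) P
  let T ← closureT A (fun a c => anyT (fun b => andT (depT I a b) (memT (b, c) R)) A)
  let E ← filterT (fun ac => orT (memT ac R)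
    (anyT (fun b => andT (memT (ac.1, b) R) (memT (b, ac.2) T)) A)) P
  pure (A, E)

/-- Step 2: the strongly connected components of the edges (each of them listed once for every
edge in it). -/
def step2 (Δ : List (Edge Loc Act)) (C : List (Edge Loc Act × Edge Loc Act)) :
    Counted (List (List (Edge Loc Act))) :=
  mapT (fun e => filterT (fun f => andT (reachT C e f) (reachT C f e)) Δ) Δ

/-- Reachability between components. -/
def leT (C : List (Edge Loc Act × Edge Loc Act)) (S₁ S₂ : List (Edge Loc Act)) : Counted Bool :=
  anyT (fun e => anyT (fun f => reachT C e f) S₂) S₁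

/-- Two components are equal if they share an edge. -/
def sameT (S₁ S₂ : List (Edge Loc Act)) : Counted Bool := anyT (fun e => memT e S₂) S₁

def nontrivialT (S : List (Edge Loc Act)) : Counted Bool :=
  anyT (fun e => orT (eqT e.tgt e.src) (anyT (fun f => notT (eqT e f)) S)) S

/-- Step 3: the minimal components with an edge that does not commute before `a`. -/
def step3 (I : List (Act × Act)) (C : List (Edge Loc Act × Edge Loc Act))
    (sccs : List (List (Edge Loc Act))) (a : Act) : Counted (List (List (Edge Loc Act))) := do
  let hit ← filterT (fun S => anyT (fun e => depT I e.label a) S) sccs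
  filterT (fun S => notT (anyT (fun S' => andT (leT C S' S) (notT (sameT S' S))) hit)) hit

/-- Step 4: the maximal components with an edge that `a` does not commute with. -/
def step4 (I : List (Act × Act)) (C : List (Edge Loc Act × Edge Loc Act))
    (sccs : List (List (Edge Loc Act))) (a : Act) : Counted (List (List (Edge Loc Act))) := do
  let hit ← filterT (fun S => anyT (fun e => depT I a e.label) S) sccs
  filterT (fun S => notT (anyT (fun S' => andT (leT C S S') (notT (sameT S S'))) hit)) hit

/-- Step 5: the search for a witnessing pair of components. `mins` and `maxs` hold the results of
the two previous steps for all actions, `E` the graph of dependence chains. -/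
def step5 (E : List (Act × Act)) (C : List (Edge Loc Act × Edge Loc Act))
    (mins maxs : List (Act × List (List (Edge Loc Act)))) : Counted Bool :=
  anyT (fun m => anyT (fun n => andT (memT (m.1, n.1) E)
    (anyT (fun S₁ => anyT (fun S₂ => andT (leT C S₁ S₂)
      (orT (notT (sameT S₁ S₂)) (nontrivialT S₁))) n.2) m.2)) maxs) mins

/-- Steps 2 to 5 for one block body with edges `Δ`: is there a witnessing pair of components? -/
def checkBlock (I : List (Act × Act)) (A : List Act) (E : List (Act × Act))
    (Δ : List (Edge Loc Act)) : Counted Bool := do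
  let C ← edgeClosureT Δ
  let sccs ← step2 Δ C
  let mins ← mapT (fun a => do
    let M ← step3 I C sccs a
    pure (a, M)) A
  let maxs ← mapT (fun a => do
    let M ← step4 I C sccs a
    pure (a, M)) A
  step5 E C mins maxs

/-- The whole algorithm; the answer `true` means that the fusion is sound. -/
def algorithm (G : CFG Loc Act) (blocks : List (Act × CFG Loc Act)) (I : List (Act × Act)) :
    Counted Bool := do
  let AE ← step1 G blocks I
  notT (anyT (fun B => checkBlock I AE.1 AE.2 B.2.edges) blocks)

end Algorithm

end ParProg

/-!
A fusion is sound if and only if the algorithm finds no witness, and the algorithm takes polynomial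
time.

*Chunks.* Every trace of `G` is a sequence of *chunks*, each of which is a trace of a block body or
a single action outside all blocks, and replacing the chunks by their block symbols gives a trace of
the outer graph (`AtomicFusion.exists_parse`). The reentry clauses of `IsInsertion` are what makes
this work at the merged end points of a block. A fused interleaving executes every chunk without
interruption (`AtomicFusion.not_linked_of_mem_fused`), and every fused interleaving is an interleaving of
`G` (`AtomicFusion.fused_subset`). So soundness says that the chunks of every interleaving can be made contiguous
by permitted swaps.

*Witnesses.* The extremal components only limit the search: a witness exists if and only if the body
of some block has a path of at least two edges from `e` to `f` and there is a dependence chain from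
`a` to `b` such that neither `(e, a)` nor `(b, f)` is in `I` (`hasWitness_iff`).

*A witness refutes soundness* (`AtomicFusion.not_sound_of_hasWitness`). Thread `0` runs up to `e`,
then one thread for each link of the chain runs from start to end, then thread `0` continues with
`f` in the same block. Swaps keep the order of two actions of different threads whose pair is not in
`I` (`Before.coveredBy`). In a fused interleaving that covers this word the whole chain would
therefore happen strictly between `e` and `f`. A link of the kind `AtRel` is no way out, since its
two actions are in one chunk and hence on the same side of every point at which another thread acts.

*Without a witness the fusion is sound* (`AtomicFusion.sound_of_not_hasWitness`). Number the
positions of an interleaving. A *delay* leads from a position to a later one of another thread that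
may not be swapped before it, and a *round* is a move within a thread (forward, or anywhere within a
chunk) followed by a delay. Delays and forward moves do not go back in time, so that a cycle of
rounds contains a round that moves back within a chunk, from `f` to `e`. Leaving the chunk at `e`
and coming back to it at `f` along the cycle spells a dependence chain, which is a witness
(`exists_back_round`, `exists_chain_of_rounds`). So rounds are well-founded. Then some chunk need
not wait for another one (`exists_free_chunk`); moving it to the front and repeating this with the
remaining events executes the chunks one after the other (`exists_serialization`).

*Running time.* With `m` the input size plus two, all lists have length at most `m` or `m ^ 2`, and
the step count of every combinator applied to arguments bounded by powers of `m` is again bounded by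
a power of `m`.
-/

namespace ParProg

/-! ### Results of the counted combinators -/

namespace Counted

variable {α β : Type}

@[simp] theorem pure_val (x : α) : (pure x : Counted α).val = x := rfl
@[simp] theorem pure_steps (x : α) : (pure x : Counted α).steps = 0 := rfl
@[simp] theorem bind_val (c : Counted α) (f : α → Counted β) :
    (c >>= f).val = (f c.val).val := rfl
@[simp] theorem bind_steps (c : Counted α) (f : α → Counted β) :
    (c >>= f).steps = c.steps + (f c.val).steps := rfl
@[simp] theorem tick_steps : tick.steps = 1 := rfl
@[simp] theorem eqT_val [DecidableEq α] (x y : α) : (eqT x y).val = decide (x = y) := rfl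
@[simp] theorem eqT_steps [DecidableEq α] (x y : α) : (eqT x y).steps = 1 := rfl

@[simp] theorem notT_val (p : Counted Bool) : (notT p).val = !p.val := rfl
@[simp] theorem notT_steps (p : Counted Bool) : (notT p).steps = p.steps + 1 := by
  simp [notT, add_comm]

@[simp] theorem andT_val (p q : Counted Bool) : (andT p q).val = (p.val && q.val) := by
  cases h : p.val <;> simp [andT, h]

@[simp] theorem orT_val (p q : Counted Bool) : (orT p q).val = (p.val || q.val) := by
  cases h : p.val <;> simp [orT, h]

@[simp] theorem anyT_val (p : α → Counted Bool) (l : List α) :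
    (anyT p l).val = l.any fun x => (p x).val := by
  induction l with
  | nil => rfl
  | cons x l ih => cases h : (p x).val <;> simp [anyT, h, ih]

@[simp] theorem filterT_val (p : α → Counted Bool) (l : List α) :
    (filterT p l).val = l.filter fun x => (p x).val := by
  induction l with
  | nil => rfl
  | cons x l ih => cases h : (p x).val <;> simp [filterT, h, ih]

@[simp] theorem mapT_val (f : α → Counted β) (l : List α) :
    (mapT f l).val = l.map fun x => (f x).val := by
  induction l with
  | nil => rfl
  | cons x l ih => simp [mapT, ih]

@[simp] theorem appendT_val (l l' : List α) : (appendT l l').val = l ++ l' := by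
  induction l with
  | nil => rfl
  | cons x l ih => simp [appendT, ih]

@[simp] theorem pairsT_val (l : List α) (l' : List β) : (pairsT l l').val = l ×ˢ l' := by
  induction l with
  | nil => rfl
  | cons x l ih => simp [pairsT, ih, List.product_cons]

@[simp] theorem memT_val [DecidableEq α] (x : α) (l : List α) :
    (memT x l).val = decide (x ∈ l) := by
  rw [Bool.eq_iff_iff]
  simp [memT]

/-! ### Step counts of the combinators -/

section Steps

variable {m : ℕ}

theorem two_mul_add_one_le_pow (hm : 2 ≤ m) {c k : ℕ} (h : c ≤ m ^ k) :
    2 * c + 1 ≤ m ^ (k + 2) := by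
  have h1 : 1 ≤ m ^ k := Nat.one_le_pow _ _ (by omega)
  have h2 : 4 ≤ m ^ 2 := by nlinarith
  calc 2 * c + 1 ≤ m ^ k * 4 := by omega
    _ ≤ m ^ k * m ^ 2 := by gcongr
    _ = m ^ (k + 2) := (pow_add _ _ _).symm

theorem add_pow_le (hm : 2 ≤ m) {c d j k : ℕ} (hc : c ≤ m ^ j) (hd : d ≤ m ^ k) :
    c + d + 1 ≤ m ^ (j + k + 2) := by
  have h1 : 1 ≤ m ^ j := Nat.one_le_pow _ _ (by omega)
  have h2 : 1 ≤ m ^ k := Nat.one_le_pow _ _ (by omega)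
  have h : m ^ j + m ^ k ≤ 2 * m ^ (j + k) := by
    rw [pow_add]; nlinarith
  have := two_mul_add_one_le_pow hm (le_refl (m ^ (j + k)))
  omega

/-- A loop over at most `m ^ j` list cells with at most `m ^ k` steps for each. -/
theorem loop_le_pow (hm : 2 ≤ m) {n c j k : ℕ} (hn : n ≤ m ^ j) (hc : c ≤ m ^ k) :
    n * (c + 1) + 1 ≤ m ^ (j + k + 2) := by
  have h2 : 1 ≤ m ^ k := Nat.one_le_pow _ _ (by omega)
  have h : n * (c + 1) ≤ 2 * m ^ (j + k) := by
    calc n * (c + 1) ≤ m ^ j * (2 * m ^ k) := Nat.mul_le_mul hn (by omega)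
      _ = 2 * m ^ (j + k) := by rw [pow_add]; ring
  have := two_mul_add_one_le_pow hm (le_refl (m ^ (j + k)))
  omega

theorem andT_steps_le (hm : 2 ≤ m) {p q : Counted Bool} {j k : ℕ} (hp : p.steps ≤ m ^ j)
    (hq : q.steps ≤ m ^ k) : (andT p q).steps ≤ m ^ (j + k + 2) := by
  refine le_trans ?_ (add_pow_le hm hp hq)
  cases h : p.val <;> simp [andT, h] <;> omega

theorem orT_steps_le (hm : 2 ≤ m) {p q : Counted Bool} {j k : ℕ} (hp : p.steps ≤ m ^ j)
    (hq : q.steps ≤ m ^ k) : (orT p q).steps ≤ m ^ (j + k + 2) := by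
  refine le_trans ?_ (add_pow_le hm hp hq)
  cases h : p.val <;> simp [orT, h] <;> omega

theorem notT_steps_le (hm : 2 ≤ m) {p : Counted Bool} {k : ℕ} (hp : p.steps ≤ m ^ k) :
    (notT p).steps ≤ m ^ (k + 2) := by
  have := two_mul_add_one_le_pow hm hp
  simp only [notT_steps]
  omega

theorem bind_steps_le (hm : 2 ≤ m) {c : Counted α} {f : α → Counted β} {j k : ℕ}
    (hc : c.steps ≤ m ^ j) (hf : (f c.val).steps ≤ m ^ k) :
    (c >>= f).steps ≤ m ^ (j + k + 2) := by
  have := add_pow_le hm hc hf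
  simp only [bind_steps]
  omega

theorem anyT_steps_le (hm : 2 ≤ m) {p : α → Counted Bool} {l : List α} {j k : ℕ}
    (hl : l.length ≤ m ^ j) (hp : ∀ x ∈ l, (p x).steps ≤ m ^ k) :
    (anyT p l).steps ≤ m ^ (j + k + 2) := by
  refine le_trans ?_ (loop_le_pow hm hl (le_refl (m ^ k)))
  clear hl
  induction l with
  | nil => simp [anyT]
  | cons x l ih =>
    have h1 := hp x (by simp)
    have h2 := ih fun y hy => hp y (by simp [hy])
    cases h : (p x).val <;> simp [anyT, h, add_mul] <;> omega

theorem filterT_steps_le (hm : 2 ≤ m) {p : α → Counted Bool} {l : List α} {j k : ℕ}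
    (hl : l.length ≤ m ^ j) (hp : ∀ x ∈ l, (p x).steps ≤ m ^ k) :
    (filterT p l).steps ≤ m ^ (j + k + 2) := by
  refine le_trans ?_ (loop_le_pow hm hl (le_refl (m ^ k)))
  clear hl
  induction l with
  | nil => simp [filterT]
  | cons x l ih =>
    have h1 := hp x (by simp)
    have h2 := ih fun y hy => hp y (by simp [hy])
    simp only [filterT, bind_steps, tick_steps, List.length_cons, add_mul]
    split <;> simp only [pure_steps] <;> omega

theorem mapT_steps_le (hm : 2 ≤ m) {f : α → Counted β} {l : List α} {j k : ℕ}
    (hl : l.length ≤ m ^ j) (hf : ∀ x ∈ l, (f x).steps ≤ m ^ k) :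
    (mapT f l).steps ≤ m ^ (j + k + 2) := by
  refine le_trans ?_ (loop_le_pow hm hl (le_refl (m ^ k)))
  clear hl
  induction l with
  | nil => simp [mapT]
  | cons x l ih =>
    have h1 := hf x (by simp)
    have h2 := ih fun y hy => hf y (by simp [hy])
    simp [mapT, add_mul]
    omega

theorem appendT_steps (l l' : List α) : (appendT l l').steps = l.length + 1 := by
  induction l with
  | nil => rfl
  | cons x l ih => simp [appendT, ih]; omega

theorem mapT_pure_steps (f : α → β) (l : List α) :
    (mapT (fun x => pure (f x)) l).steps = l.length + 1 := by
  induction l with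
  | nil => rfl
  | cons x l ih => simp [mapT, ih]; omega

theorem pairsT_steps_le (hm : 2 ≤ m) {l : List α} {l' : List β} {j k : ℕ}
    (hl : l.length ≤ m ^ j) (hl' : l'.length ≤ m ^ k) :
    (pairsT l l').steps ≤ m ^ (j + (k + 4) + 2) := by
  have h3 : 2 * l'.length + 2 ≤ m ^ (k + 4) := by
    have h1 := two_mul_add_one_le_pow hm hl'
    have h2 := two_mul_add_one_le_pow hm h1
    have h4 : k + 2 + 2 = k + 4 := by omega
    rw [h4] at h2
    omega
  refine le_trans ?_ (loop_le_pow hm hl h3)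
  clear hl
  induction l with
  | nil => simp [pairsT]
  | cons x l ih =>
    simp only [pairsT, bind_steps, tick_steps, appendT_steps, mapT_val, List.length_map,
      mapT_pure_steps, List.length_cons, add_mul]
    omega

theorem memT_steps_le (hm : 2 ≤ m) [DecidableEq α] {x : α} {l : List α} {j : ℕ}
    (hl : l.length ≤ m ^ j) : (memT x l).steps ≤ m ^ (j + 2) :=
  anyT_steps_le (k := 0) hm hl fun _ _ => by simp

theorem length_product_le_pow {l : List α} {l' : List β} {j k : ℕ} (hl : l.length ≤ m ^ j)
    (hl' : l'.length ≤ m ^ k) : (l ×ˢ l').length ≤ m ^ (j + k) := by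
  rw [List.length_product, pow_add]
  exact Nat.mul_le_mul hl hl'

theorem warshallT_length_le [DecidableEq α] (P : List (α × α)) (W : List α) (R : List (α × α))
    (hR : R.length ≤ P.length) : (warshallT P W R).val.length ≤ P.length := by
  induction W generalizing R with
  | nil => simpa [warshallT] using hR
  | cons w W ih =>
    simp only [warshallT, bind_val]
    exact ih _ (by simpa using List.length_filter_le _ _)

theorem warshallT_steps_le (hm : 2 ≤ m) [DecidableEq α] {P : List (α × α)} {W : List α}
    {R : List (α × α)} {j k : ℕ} (hW : W.length ≤ m ^ j) (hP : P.length ≤ m ^ k)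
    (hR : R.length ≤ P.length) : (warshallT P W R).steps ≤ m ^ (j + (4 * k + 12) + 2) := by
  refine le_trans ?_ (loop_le_pow hm hW (le_refl (m ^ (4 * k + 12))))
  clear hW
  induction W generalizing R with
  | nil => simp [warshallT]
  | cons w W ih =>
    have hR' := hR.trans hP
    have h1 : (filterT (fun xy : α × α => orT (memT xy R)
        (andT (memT (xy.1, w) R) (memT (w, xy.2) R))) P).steps ≤ m ^ (4 * k + 12) := by
      refine (filterT_steps_le hm hP fun xy _ => orT_steps_le hm (memT_steps_le hm hR')
        (andT_steps_le hm (memT_steps_le hm hR') (memT_steps_le hm hR'))).trans ?_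
      exact Nat.pow_le_pow_right (by omega) (by omega)
    simp only [warshallT, bind_steps, tick_steps, List.length_cons, add_mul]
    have h2 := ih (R := (filterT (fun xy : α × α => orT (memT xy R)
        (andT (memT (xy.1, w) R) (memT (w, xy.2) R))) P).val)
        (by simpa using List.length_filter_le _ _)
    omega

theorem closureT_length_le [DecidableEq α] {V : List α} (r : α → α → Counted Bool) {j : ℕ}
    (hV : V.length ≤ m ^ j) : (closureT V r).val.length ≤ m ^ (2 * j) := by
  simp only [closureT, bind_val]
  refine (warshallT_length_le _ _ _ (by simpa using List.length_filter_le _ _)).trans ?_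
  rw [two_mul, pairsT_val]
  exact length_product_le_pow hV hV

theorem closureT_steps_le (hm : 2 ≤ m) [DecidableEq α] {V : List α} {r : α → α → Counted Bool}
    {j k : ℕ} (hV : V.length ≤ m ^ j) (hr : ∀ x ∈ V, ∀ y ∈ V, (r x y).steps ≤ m ^ k) :
    (closureT V r).steps ≤ m ^ (13 * j + k + 26) := by
  have hP : (V ×ˢ V).length ≤ m ^ (2 * j) := by
    rw [two_mul]; exact length_product_le_pow hV hV
  have h3 := bind_steps_le (f := fun P => do
    let R ← filterT (fun xy : α × α => r xy.1 xy.2) P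
    warshallT P V R) hm (pairsT_steps_le hm hV hV) (bind_steps_le hm
      (filterT_steps_le (k := k) hm (by simpa using hP) (fun xy hxy => by
        have h : xy ∈ V ×ˢ V := by simpa using hxy
        obtain ⟨h1, h2⟩ := List.mem_product.1 h
        exact hr _ h1 _ h2))
      (warshallT_steps_le hm hV (by simpa using hP) (by simpa using List.length_filter_le _ _)))
  exact h3.trans (Nat.pow_le_pow_right (by omega) (by omega))

end Steps

end Counted

/-! ### The running time of the algorithm -/

section Cost

open Counted

variable {Loc Act : Type} [DecidableEq Loc] [DecidableEq Act] {m : ℕ}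
  {Δ : List (Edge Loc Act)} {C : List (Edge Loc Act × Edge Loc Act)} {I E : List (Act × Act)}
  {A : List Act}

theorem edgeClosureT_length_le (hΔ : Δ.length ≤ m ^ 1) :
    (edgeClosureT Δ).val.length ≤ m ^ 2 :=
  closureT_length_le _ hΔ

theorem edgeClosureT_steps_le (hm : 2 ≤ m) (hΔ : Δ.length ≤ m ^ 1) :
    (edgeClosureT Δ).steps ≤ m ^ 39 :=
  closureT_steps_le (j := 1) (k := 0) hm hΔ fun _ _ _ _ => by simp

theorem reachT_steps_le (hm : 2 ≤ m) (hC : C.length ≤ m ^ 2) (e f : Edge Loc Act) :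
    (reachT C e f).steps ≤ m ^ 6 :=
  orT_steps_le (j := 0) hm (by simp) (memT_steps_le hm hC)

theorem depT_steps_le (hm : 2 ≤ m) (hI : I.length ≤ m ^ 1) (a b : Act) :
    (depT I a b).steps ≤ m ^ 5 :=
  notT_steps_le hm (memT_steps_le hm hI)

theorem progOrderT_steps_le (hm : 2 ≤ m) (hΔ : Δ.length ≤ m ^ 1) (hC : C.length ≤ m ^ 2)
    (a b : Act) : (progOrderT Δ C a b).steps ≤ m ^ 16 :=
  anyT_steps_le hm hΔ fun _ _ => andT_steps_le (j := 0) hm (by simp) <|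
    anyT_steps_le hm hΔ fun _ _ => andT_steps_le (j := 0) hm (by simp) (reachT_steps_le hm hC _ _)

theorem atRelT_steps_le (hm : 2 ≤ m)
    {bodies : List (List (Edge Loc Act) × List (Edge Loc Act × Edge Loc Act))}
    (hb : bodies.length ≤ m ^ 1)
    (hB : ∀ B ∈ bodies, B.1.length ≤ m ^ 1 ∧ B.2.length ≤ m ^ 2) (a b : Act) :
    (atRelT bodies a b).steps ≤ m ^ 17 :=
  anyT_steps_le hm hb fun B h => anyT_steps_le hm (hB B h).1 fun _ _ =>
    andT_steps_le (j := 0) hm (by simp) <| anyT_steps_le hm (hB B h).1 fun _ _ =>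
      andT_steps_le (j := 0) hm (by simp) (memT_steps_le hm (hB B h).2)

theorem step1_steps_le (hm : 2 ≤ m) {G : CFG Loc Act} {blocks : List (Act × CFG Loc Act)}
    (hG : G.edges.length ≤ m ^ 1) (hb : blocks.length ≤ m ^ 1)
    (hB : ∀ B ∈ blocks, B.2.edges.length ≤ m ^ 1) (hI : I.length ≤ m ^ 1) :
    (step1 G blocks I).steps ≤ m ^ 255 := by
  have hA : (mapT (fun e : Edge Loc Act => (pure e.label : Counted Act)) G.edges).val.length
      ≤ m ^ 1 := by simpa using hG
  have hP : ∀ A : List Act, A.length ≤ m ^ 1 → (pairsT A A).val.length ≤ m ^ 2 := fun A h => by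
    rw [pairsT_val]; exact length_product_le_pow h h
  have hR : ∀ (p : Act × Act → Counted Bool) (P : List (Act × Act)), P.length ≤ m ^ 2 →
      (filterT p P).val.length ≤ m ^ 2 := fun p P h => by
    rw [filterT_val]; exact (List.length_filter_le _ _).trans h
  unfold step1
  refine (bind_steps_le (j := 3) hm (mapT_steps_le (k := 0) hm hG (by simp)) <|
    bind_steps_le hm (edgeClosureT_steps_le hm hG) <|
    bind_steps_le (j := 1 + (39 + 0 + 2) + 2) hm (mapT_steps_le hm hb fun B h =>
      bind_steps_le (k := 0) hm (edgeClosureT_steps_le hm (hB B h)) (by simp)) <|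
    bind_steps_le hm (pairsT_steps_le hm hA hA) <|
    bind_steps_le hm (filterT_steps_le hm (hP _ hA) fun _ _ =>
      orT_steps_le hm (progOrderT_steps_le hm hG (edgeClosureT_length_le hG) _ _)
        (atRelT_steps_le hm (by simpa using hb) ?_ _ _)) <|
    bind_steps_le hm (closureT_steps_le hm hA fun _ _ _ _ =>
      anyT_steps_le hm hA fun _ _ => andT_steps_le hm (depT_steps_le hm hI _ _)
        (memT_steps_le hm (hR _ _ (hP _ hA)))) <|
    bind_steps_le (k := 0) hm (filterT_steps_le hm (hP _ hA) fun _ _ =>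
      orT_steps_le hm (memT_steps_le hm (hR _ _ (hP _ hA))) <|
        anyT_steps_le hm hA fun _ _ => andT_steps_le hm (memT_steps_le hm (hR _ _ (hP _ hA)))
          (memT_steps_le hm (closureT_length_le _ hA))) (by simp)).trans
    (Nat.pow_le_pow_right (by omega) (by norm_num))
  intro B h
  simp only [mapT_val, bind_val, pure_val, List.mem_map] at h
  obtain ⟨B, h, rfl⟩ := h
  exact ⟨hB B h, edgeClosureT_length_le (hB B h)⟩

theorem step1_lengths_le {G : CFG Loc Act} {blocks : List (Act × CFG Loc Act)}
    (hG : G.edges.length ≤ m ^ 1) :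
    (step1 G blocks I).val.1.length ≤ m ^ 1 ∧ (step1 G blocks I).val.2.length ≤ m ^ 2 := by
  simp only [step1, bind_val, mapT_val, pairsT_val, filterT_val, pure_val, List.length_map]
  refine ⟨hG, (List.length_filter_le _ _).trans (length_product_le_pow (j := 1) (k := 1) ?_ ?_)⟩ <;>
  simpa using hG

theorem leT_steps_le (hm : 2 ≤ m) (hC : C.length ≤ m ^ 2) {S S' : List (Edge Loc Act)}
    (hS : S.length ≤ m ^ 1) (hS' : S'.length ≤ m ^ 1) : (leT C S S').steps ≤ m ^ 12 :=
  anyT_steps_le hm hS fun _ _ => anyT_steps_le hm hS' fun _ _ => reachT_steps_le hm hC _ _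

theorem sameT_steps_le (hm : 2 ≤ m) {S S' : List (Edge Loc Act)}
    (hS : S.length ≤ m ^ 1) (hS' : S'.length ≤ m ^ 1) : (sameT S S').steps ≤ m ^ 6 :=
  anyT_steps_le hm hS fun _ _ => memT_steps_le hm hS'

theorem nontrivialT_steps_le (hm : 2 ≤ m) {S : List (Edge Loc Act)} (hS : S.length ≤ m ^ 1) :
    (nontrivialT S).steps ≤ m ^ 10 :=
  anyT_steps_le hm hS fun _ _ => orT_steps_le (j := 0) hm (by simp) <|
    anyT_steps_le hm hS fun _ _ => notT_steps_le (k := 0) hm (by simp)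

variable {sccs : List (List (Edge Loc Act))}

theorem step2_steps_le (hm : 2 ≤ m) (hΔ : Δ.length ≤ m ^ 1) (hC : C.length ≤ m ^ 2) :
    (step2 Δ C).steps ≤ m ^ 20 :=
  mapT_steps_le hm hΔ fun _ _ => filterT_steps_le hm hΔ fun _ _ =>
    andT_steps_le hm (reachT_steps_le hm hC _ _) (reachT_steps_le hm hC _ _)

theorem step2_lengths_le (hΔ : Δ.length ≤ m ^ 1) : (step2 Δ C).val.length ≤ m ^ 1 ∧
    ∀ S ∈ (step2 Δ C).val, S.length ≤ m ^ 1 := by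
  simp only [step2, mapT_val, filterT_val, List.length_map, List.mem_map]
  refine ⟨hΔ, ?_⟩
  rintro _ ⟨e, -, rfl⟩
  exact (List.length_filter_le _ _).trans hΔ

omit [DecidableEq Loc] [DecidableEq Act] in
/-- The common shape of the searches for minimal and for maximal components. -/
theorem extremal_steps_le (hm : 2 ≤ m) (hs : sccs.length ≤ m ^ 1)
    (hS : ∀ S ∈ sccs, S.length ≤ m ^ 1) {p : Edge Loc Act → Counted Bool}
    {q : List (Edge Loc Act) → List (Edge Loc Act) → Counted Bool}
    (hp : ∀ e, (p e).steps ≤ m ^ 5)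
    (hq : ∀ S ∈ sccs, ∀ S' ∈ sccs, (q S S').steps ≤ m ^ 22) :
    (filterT (fun S => anyT p S) sccs >>= fun hit =>
      filterT (fun S => notT (anyT (fun S' => q S S') hit)) hit).steps ≤ m ^ 44 := by
  have hh : (filterT (fun S => anyT p S) sccs).val.length ≤ m ^ 1 := by
    rw [filterT_val]; exact (List.length_filter_le _ _).trans hs
  have hsub : ∀ S ∈ (filterT (fun S => anyT p S) sccs).val, S ∈ sccs := fun S h => by
    rw [filterT_val] at h; exact List.mem_of_mem_filter h
  exact (bind_steps_le hm (filterT_steps_le hm hs fun S h => anyT_steps_le hm (hS S h)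
      fun e _ => hp e) <| filterT_steps_le hm hh fun S h => notT_steps_le hm <|
    anyT_steps_le hm hh fun S' h' => hq S (hsub S h) S' (hsub S' h')).trans
    (Nat.pow_le_pow_right (by omega) (by norm_num))

theorem step3_steps_le (hm : 2 ≤ m) (hs : sccs.length ≤ m ^ 1)
    (hS : ∀ S ∈ sccs, S.length ≤ m ^ 1) (hC : C.length ≤ m ^ 2) (hI : I.length ≤ m ^ 1)
    (a : Act) : (step3 I C sccs a).steps ≤ m ^ 44 :=
  extremal_steps_le hm hs hS (fun _ => depT_steps_le hm hI _ _) fun S h S' h' =>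
    andT_steps_le hm (leT_steps_le hm hC (hS S' h') (hS S h))
      (notT_steps_le hm (sameT_steps_le hm (hS S' h') (hS S h)))

theorem step4_steps_le (hm : 2 ≤ m) (hs : sccs.length ≤ m ^ 1)
    (hS : ∀ S ∈ sccs, S.length ≤ m ^ 1) (hC : C.length ≤ m ^ 2) (hI : I.length ≤ m ^ 1)
    (a : Act) : (step4 I C sccs a).steps ≤ m ^ 44 :=
  extremal_steps_le hm hs hS (fun _ => depT_steps_le hm hI _ _) fun S h S' h' =>
    andT_steps_le hm (leT_steps_le hm hC (hS S h) (hS S' h'))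
      (notT_steps_le hm (sameT_steps_le hm (hS S h) (hS S' h')))

theorem step3_sublist (a : Act) : (step3 I C sccs a).val.Sublist sccs := by
  simp only [step3, bind_val, filterT_val]
  exact List.filter_sublist.trans List.filter_sublist

theorem step4_sublist (a : Act) : (step4 I C sccs a).val.Sublist sccs := by
  simp only [step4, bind_val, filterT_val]
  exact List.filter_sublist.trans List.filter_sublist

theorem step5_steps_le (hm : 2 ≤ m) (hE : E.length ≤ m ^ 2) (hC : C.length ≤ m ^ 2)
    {mins maxs : List (Act × List (List (Edge Loc Act)))}
    (h₁ : mins.length ≤ m ^ 1) (h₂ : maxs.length ≤ m ^ 1)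
    (h₃ : ∀ x ∈ mins, x.2.length ≤ m ^ 1 ∧ ∀ S ∈ x.2, S.length ≤ m ^ 1)
    (h₄ : ∀ x ∈ maxs, x.2.length ≤ m ^ 1 ∧ ∀ S ∈ x.2, S.length ≤ m ^ 1) :
    (step5 E C mins maxs).steps ≤ m ^ 52 :=
  (anyT_steps_le hm h₁ fun x hx => anyT_steps_le hm h₂ fun y hy =>
    andT_steps_le hm (memT_steps_le hm hE) <| anyT_steps_le hm (h₃ x hx).1 fun S hS =>
      anyT_steps_le hm (h₄ y hy).1 fun S' hS' =>
        andT_steps_le hm (leT_steps_le hm hC ((h₃ x hx).2 S hS) ((h₄ y hy).2 S' hS')) <|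
          orT_steps_le hm (notT_steps_le hm
            (sameT_steps_le hm ((h₃ x hx).2 S hS) ((h₄ y hy).2 S' hS')))
            (nontrivialT_steps_le hm ((h₃ x hx).2 S hS))).trans
    (Nat.pow_le_pow_right (by omega) (by norm_num))

theorem checkBlock_steps_le (hm : 2 ≤ m) (hA : A.length ≤ m ^ 1) (hE : E.length ≤ m ^ 2)
    (hΔ : Δ.length ≤ m ^ 1) (hI : I.length ≤ m ^ 1) :
    (checkBlock I A E Δ).steps ≤ m ^ 225 := by
  have hC : (edgeClosureT Δ).val.length ≤ m ^ 2 := edgeClosureT_length_le hΔ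
  have hs := step2_lengths_le (C := (edgeClosureT Δ).val) hΔ
  refine (bind_steps_le hm (edgeClosureT_steps_le hm hΔ) <|
    bind_steps_le hm (step2_steps_le hm hΔ hC) <|
    bind_steps_le hm (mapT_steps_le hm hA fun a _ => bind_steps_le (k := 0) hm
      (step3_steps_le hm hs.1 hs.2 hC hI a) (by simp)) <|
    bind_steps_le hm (mapT_steps_le hm hA fun a _ => bind_steps_le (k := 0) hm
      (step4_steps_le hm hs.1 hs.2 hC hI a) (by simp)) <|
    step5_steps_le hm hE hC (by simpa using hA) (by simpa using hA) ?_ ?_).trans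
    (Nat.pow_le_pow_right (by omega) (by norm_num))
  all_goals
    simp only [mapT_val, bind_val, pure_val, List.mem_map]
    rintro _ ⟨a, -, rfl⟩
  · exact ⟨(step3_sublist a).length_le.trans hs.1, fun S h => hs.2 S ((step3_sublist a).subset h)⟩
  · exact ⟨(step4_sublist a).length_le.trans hs.1, fun S h => hs.2 S ((step4_sublist a).subset h)⟩

set_option exponentiation.threshold 1000 in
/-- The algorithm runs in polynomial time. The exponent is what the crude calculus above yields;
no attempt is made to keep it small. -/
theorem algorithm_steps_le (G : CFG Loc Act) (F : AtomicFusion G) (I : List (Act × Act)) :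
    (algorithm G F.blocks I).steps ≤ (inputSize G F I + 2) ^ 500 := by
  have hm : 2 ≤ inputSize G F I + 2 := by omega
  have hG : G.edges.length ≤ (inputSize G F I + 2) ^ 1 := by
    simp only [pow_one, inputSize, CFG.size]; omega
  have hI : I.length ≤ (inputSize G F I + 2) ^ 1 := by
    simp only [pow_one, inputSize]; omega
  have hb : F.blocks.length ≤ (inputSize G F I + 2) ^ 1 := by
    have : F.blocks.length ≤ (F.blocks.map fun B => B.2.size + 1).sum := by
      induction F.blocks with
      | nil => simp
      | cons B l ih => simp only [List.length_cons, List.map_cons, List.sum_cons]; omega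
    simp only [pow_one, inputSize]; omega
  have hB : ∀ B ∈ F.blocks, B.2.edges.length ≤ (inputSize G F I + 2) ^ 1 := fun B h => by
    have := List.le_sum_of_mem (List.mem_map_of_mem (f := fun B => B.2.size + 1) h)
    simp only [pow_one, inputSize, CFG.size] at *; omega
  refine (bind_steps_le hm (step1_steps_le hm hG hb hB hI) <| notT_steps_le hm <|
    anyT_steps_le hm hb fun B h => checkBlock_steps_le hm (step1_lengths_le hG).1
      (step1_lengths_le hG).2 (hB B h) hI).trans (Nat.pow_le_pow_right (by omega) (by norm_num))

end Cost

/-! ### Transitive closure -/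

namespace Counted

variable {α : Type} [DecidableEq α]

/-- Warshall's algorithm only adds pairs that every transitive relation containing `R` contains. -/
theorem warshallT_sound {T : α → α → Prop} (hT : ∀ x y z, T x y → T y z → T x z)
    (P : List (α × α)) (W : List α) (R : List (α × α)) (hR : ∀ xy ∈ R, T xy.1 xy.2) :
    ∀ xy ∈ (warshallT P W R).val, T xy.1 xy.2 := by
  induction W generalizing R with
  | nil => simpa [warshallT] using hR
  | cons w W ih =>
    simp only [warshallT, bind_val]
    refine ih _ fun xy h => ?_
    simp only [filterT_val, List.mem_filter, orT_val, andT_val, memT_val, Bool.or_eq_true,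
      Bool.and_eq_true, decide_eq_true_eq] at h
    rcases h.2 with h | ⟨h, h'⟩
    · exact hR _ h
    · exact hT _ _ _ (hR (xy.1, w) h) (hR (w, xy.2) h')

theorem subset_warshallT (P : List (α × α)) (W : List α) (R : List (α × α)) (hR : R ⊆ P) :
    R ⊆ (warshallT P W R).val := by
  induction W generalizing R with
  | nil => simp [warshallT]
  | cons w W ih =>
    simp only [warshallT, bind_val]
    refine List.Subset.trans (fun xy h => ?_) (ih _ ?_)
    · simp [h, hR h]
    · simp

/-- The invariant of Warshall's algorithm: if the pairs found so far can be composed at the points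
of `S`, then in the end they can be composed at the points of `S` and of `W`. -/
theorem warshallT_trans (V : List α) (W : List α) (R : List (α × α)) (hR : R ⊆ V ×ˢ V)
    (S : Set α) (hS : ∀ x y, ∀ v ∈ S, (x, v) ∈ R → (v, y) ∈ R → (x, y) ∈ R) :
    ∀ x y, ∀ v, v ∈ S ∨ v ∈ W → (x, v) ∈ (warshallT (V ×ˢ V) W R).val →
      (v, y) ∈ (warshallT (V ×ˢ V) W R).val → (x, y) ∈ (warshallT (V ×ˢ V) W R).val := by
  induction W generalizing R S with
  | nil => simpa [warshallT] using hS
  | cons w W ih =>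
    simp only [warshallT, bind_val]
    set R' := (filterT (fun xy : α × α => orT (memT xy R)
      (andT (memT (xy.1, w) R) (memT (w, xy.2) R))) (V ×ˢ V)).val with hR'
    have hmem : ∀ x y, (x, y) ∈ R' ↔ (x, y) ∈ R ∨ (x, w) ∈ R ∧ (w, y) ∈ R := by
      intro x y
      simp only [hR', filterT_val, List.mem_filter, orT_val, andT_val, memT_val, Bool.or_eq_true,
        Bool.and_eq_true, decide_eq_true_eq, and_iff_right_iff_imp]
      rintro (h | ⟨h, h'⟩)
      · exact hR h
      · exact List.mem_product.2 ⟨(List.mem_product.1 (hR h)).1, (List.mem_product.1 (hR h')).2⟩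
    intro x y v hv
    refine ih R' (by simp [hR']) (S ∪ {w}) ?_ x y v ?_
    · intro x y v hv h h'
      rw [hmem] at h h' ⊢
      rcases hv with hv | rfl
      · have key := fun x y => hS x y v hv
        rcases h with h | ⟨h, h1⟩ <;> rcases h' with h' | ⟨h', h2⟩
        · exact Or.inl (key _ _ h h')
        · exact Or.inr ⟨key _ _ h h', h2⟩
        · exact Or.inr ⟨h, key _ _ h1 h'⟩
        · exact Or.inr ⟨h, h2⟩
      · exact Or.inr ⟨h.elim id And.left, h'.elim id And.right⟩
    · simp only [List.mem_cons] at hv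
      simp only [Set.mem_union, Set.mem_singleton_iff]
      tauto

theorem mem_closureT {V : List α} {r : α → α → Counted Bool} {x y : α} :
    (x, y) ∈ (closureT V r).val ↔
      Relation.TransGen (fun x y => x ∈ V ∧ y ∈ V ∧ (r x y).val = true) x y := by
  simp only [closureT, bind_val, pairsT_val]
  set R := (filterT (fun xy : α × α => r xy.1 xy.2) (V ×ˢ V)).val with hR
  have hsub : R ⊆ V ×ˢ V := by simp [hR]
  have hmem : ∀ x y, (x, y) ∈ R ↔ x ∈ V ∧ y ∈ V ∧ (r x y).val = true := fun x y => by
    simp [hR, List.mem_product, and_assoc]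
  constructor
  · exact fun h => warshallT_sound (fun _ _ _ => Relation.TransGen.trans) _ V R
      (fun xy h => Relation.TransGen.single ((hmem _ _).1 h)) _ h
  · intro h
    have hR := subset_warshallT _ V R hsub
    induction h with
    | single h => exact hR ((hmem _ _).2 h)
    | tail _ h ih =>
      exact warshallT_trans V V R hsub ∅ (by simp) _ _ _ (Or.inr h.1) ih (hR ((hmem _ _).2 h))

end Counted

/-! ### Runs and paths of edges -/

section Paths

variable {Loc Act : Type} {Δ : List (Edge Loc Act)}

/-- The edge `f` can follow the edge `e`. -/
def EdgeStep (Δ : List (Edge Loc Act)) (e f : Edge Loc Act) : Prop :=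
  e ∈ Δ ∧ f ∈ Δ ∧ e.tgt = f.src

theorem edgeReach_iff {B : CFG Loc Act} {e f : Edge Loc Act} :
    EdgeReach B e f ↔ Relation.ReflTransGen (EdgeStep B.edges) e f := Iff.rfl

theorem Run.append {ℓ ℓ₁ ℓ₂ : Loc} {τ τ' : List Act} (h : Run Δ ℓ τ ℓ₁) (h' : Run Δ ℓ₁ τ' ℓ₂) :
    Run Δ ℓ (τ ++ τ') ℓ₂ := by
  induction h with
  | nil => exact h'
  | cons he _ ih => exact Run.cons he (ih h')

theorem run_append_iff {ℓ ℓ₂ : Loc} {τ τ' : List Act} :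
    Run Δ ℓ (τ ++ τ') ℓ₂ ↔ ∃ ℓ₁, Run Δ ℓ τ ℓ₁ ∧ Run Δ ℓ₁ τ' ℓ₂ := by
  refine ⟨fun h => ?_, fun ⟨_, h, h'⟩ => h.append h'⟩
  induction τ generalizing ℓ with
  | nil => exact ⟨ℓ, .nil ℓ, h⟩
  | cons a τ ih =>
    cases h with
    | cons he h =>
      obtain ⟨ℓ₁, h1, h2⟩ := ih h
      exact ⟨ℓ₁, .cons he h1, h2⟩

theorem run_cons_iff {ℓ ℓ₂ : Loc} {a : Act} {τ : List Act} :
    Run Δ ℓ (a :: τ) ℓ₂ ↔ ∃ ℓ₁, (ℓ, a, ℓ₁) ∈ Δ ∧ Run Δ ℓ₁ τ ℓ₂ := by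
  refine ⟨fun h => ?_, fun ⟨_, h, h'⟩ => .cons h h'⟩
  cases h with
  | cons he h => exact ⟨_, he, h⟩

theorem run_nil_iff {ℓ ℓ' : Loc} : Run Δ ℓ [] ℓ' ↔ ℓ = ℓ' := by
  refine ⟨fun h => ?_, fun h => h ▸ .nil ℓ⟩
  cases h
  rfl

theorem Run.single {e : Edge Loc Act} (he : e ∈ Δ) : Run Δ e.src [e.label] e.tgt :=
  .cons he (.nil _)

theorem Run.exists_edge {ℓ ℓ' : Loc} {τ : List Act} (h : Run Δ ℓ τ ℓ') {a : Act} (ha : a ∈ τ) :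
    ∃ e ∈ Δ, e.label = a := by
  induction h with
  | nil => simp at ha
  | cons he _ ih =>
    rcases List.mem_cons.1 ha with rfl | ha
    · exact ⟨_, he, rfl⟩
    · exact ih ha

theorem exists_run_of_edgeReach {e f : Edge Loc Act} (he : e ∈ Δ)
    (h : Relation.ReflTransGen (EdgeStep Δ) e f) :
    ∃ ι, Run Δ e.src ι f.tgt ∧ ι.head? = some e.label ∧ ι.getLast? = some f.label := by
  induction h with
  | refl => exact ⟨_, Run.single he, rfl, rfl⟩
  | tail _ h ih =>
    obtain ⟨ι, h1, h2, h3⟩ := ih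
    rw [h.2.2] at h1
    exact ⟨_, h1.append (Run.single h.2.1), by simp [h2], by simp⟩

/-- A path of at least two edges, as a run. -/
theorem exists_run_of_transGen {e f : Edge Loc Act}
    (h : Relation.TransGen (EdgeStep Δ) e f) :
    ∃ ι, Run Δ e.src ([e.label] ++ ι ++ [f.label]) f.tgt := by
  induction h with
  | single h =>
    exact ⟨[], (Run.single h.1).append (h.2.2 ▸ Run.single h.2.1)⟩
  | tail _ h ih =>
    obtain ⟨ι, h1⟩ := ih
    exact ⟨ι ++ [_], by simpa using h1.append (h.2.2 ▸ Run.single h.2.1)⟩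

theorem Run.exists_transGen {ℓ ℓ₁ ℓ' : Loc} {a b : Act} {τ : List Act} (he : (ℓ, a, ℓ₁) ∈ Δ)
    (h : Run Δ ℓ₁ τ ℓ') (hb : b ∈ τ) :
    ∃ f ∈ Δ, f.label = b ∧ Relation.TransGen (EdgeStep Δ) (ℓ, a, ℓ₁) f := by
  induction h generalizing ℓ a with
  | nil => simp at hb
  | cons hf _ ih =>
    rcases List.mem_cons.1 hb with rfl | hb
    · exact ⟨_, hf, rfl, .single ⟨he, hf, rfl⟩⟩
    · obtain ⟨g, hg, rfl, h⟩ := ih hf hb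
      exact ⟨g, hg, rfl, .head ⟨he, hf, rfl⟩ h⟩

/-- Two letters of a run, one before the other, come from a path of at least two edges. -/
theorem Run.exists_transGen_of_sublist {ℓ ℓ' : Loc} {a b : Act} {τ : List Act}
    (h : Run Δ ℓ τ ℓ') (hab : [a, b].Sublist τ) :
    ∃ e ∈ Δ, ∃ f ∈ Δ, e.label = a ∧ f.label = b ∧ Relation.TransGen (EdgeStep Δ) e f := by
  induction h with
  | nil => simp at hab
  | cons he h ih =>
    rcases List.cons_sublist_cons'.1 hab with hab | ⟨rfl, hb⟩
    · exact ih hab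
    · obtain ⟨f, hf, rfl, hef⟩ := h.exists_transGen he (by simpa using hb)
      exact ⟨_, he, f, hf, rfl, rfl, hef⟩

namespace CFG

variable {G : CFG Loc Act}

theorem edge_ext {e f : Edge Loc Act} (he : e ∈ G.edges) (hf : f ∈ G.edges)
    (h : e.label = f.label) : e = f :=
  List.inj_on_of_nodup_map G.labels_nodup he hf h

theorem exists_trace_of_run {ℓ ℓ' : Loc} {τ : List Act} (hℓ : ℓ ∈ G.locs) (hℓ' : ℓ' ∈ G.locs)
    (h : Run G.edges ℓ τ ℓ') : ∃ ρ σ, ρ ++ τ ++ σ ∈ G.traces := by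
  obtain ⟨ρ, hρ⟩ := G.reachable ℓ hℓ
  obtain ⟨σ, hσ⟩ := G.coreachable ℓ' hℓ'
  exact ⟨ρ, σ, (hρ.append h).append hσ⟩

end CFG

theorem progOrder_iff {G : CFG Loc Act} {a b : Act} : ProgOrder G a b ↔
    ∃ e ∈ G.edges, ∃ f ∈ G.edges, e.label = a ∧ f.label = b ∧ EdgeReach G e f := by
  constructor
  · rintro ⟨ρ, ι, σ, h, ha, hb⟩
    obtain ⟨ℓ₁, h1, -⟩ := run_append_iff.1 h
    obtain ⟨ℓ₂, -, h2⟩ := run_append_iff.1 h1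
    cases ι with
    | nil => simp at ha
    | cons c ι =>
      obtain rfl : c = a := by simpa using ha
      obtain ⟨ℓ₃, he, h3⟩ := run_cons_iff.1 h2
      rcases List.mem_cons.1 (List.mem_of_getLast? hb) with rfl | hb
      · exact ⟨_, he, _, he, rfl, rfl, .refl⟩
      · obtain ⟨f, hf, rfl, h⟩ := h3.exists_transGen he hb
        exact ⟨_, he, f, hf, rfl, rfl, h.to_reflTransGen⟩
  · rintro ⟨e, he, f, hf, rfl, rfl, h⟩
    obtain ⟨ι, h1, h2, h3⟩ := exists_run_of_edgeReach he h
    obtain ⟨ρ, σ, h4⟩ := G.exists_trace_of_run (G.src_mem _ he) (G.tgt_mem _ hf) h1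
    exact ⟨ρ, ι, σ, h4, h2, h3⟩

theorem atRel_iff {blocks : List (Act × CFG Loc Act)} {a b : Act} : AtRel blocks a b ↔
    ∃ B ∈ blocks, ∃ e ∈ B.2.edges, ∃ f ∈ B.2.edges, e.label = b ∧ f.label = a ∧
      Relation.TransGen (EdgeStep B.2.edges) e f := by
  constructor
  · rintro ⟨B, hB, ρ, ι, σ, h⟩
    obtain ⟨e, he, f, hf, h1, h2, h3⟩ := Run.exists_transGen_of_sublist (a := b) (b := a) h (by
      have : ρ ++ [b] ++ ι ++ [a] ++ σ = ρ ++ ([b] ++ (ι ++ ([a] ++ σ))) := by simp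
      rw [this]
      refine List.Sublist.trans ?_ (List.sublist_append_right _ _)
      refine List.Sublist.append (l₁ := [b]) (r₁ := [a]) (List.Sublist.refl _) ?_
      refine List.Sublist.trans ?_ (List.sublist_append_right _ _)
      exact List.sublist_append_left _ _)
    exact ⟨B, hB, e, he, f, hf, h1, h2, h3⟩
  · rintro ⟨B, hB, e, he, f, hf, rfl, rfl, h⟩
    obtain ⟨ι, h1⟩ := exists_run_of_transGen h
    obtain ⟨ρ, σ, h2⟩ := B.2.exists_trace_of_run (B.2.src_mem _ he) (B.2.tgt_mem _ hf) h1
    exact ⟨B, hB, ρ, ι, σ, by simpa using h2⟩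

end Paths

/-! ### Correctness of the algorithm -/

section Correctness

open Counted Relation

variable {Loc Act : Type}

theorem link_mem_alphabet {G : CFG Loc Act} {blocks : List (Act × CFG Loc Act)}
    (hsub : ∀ B ∈ blocks, B.2.alphabet ⊆ G.alphabet) {a b : Act} (h : Link G blocks a b) :
    a ∈ G.alphabet ∧ b ∈ G.alphabet := by
  rcases h with h | h
  · obtain ⟨e, he, f, hf, rfl, rfl, -⟩ := progOrder_iff.1 h
    exact ⟨⟨e, he, rfl⟩, ⟨f, hf, rfl⟩⟩
  · obtain ⟨B, hB, e, he, f, hf, rfl, rfl, -⟩ := atRel_iff.1 h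
    exact ⟨hsub B hB ⟨f, hf, rfl⟩, hsub B hB ⟨e, he, rfl⟩⟩

variable [DecidableEq Loc] [DecidableEq Act]

theorem mem_edgeClosureT {Δ : List (Edge Loc Act)} {e f : Edge Loc Act} :
    (e, f) ∈ (edgeClosureT Δ).val ↔ TransGen (EdgeStep Δ) e f := by
  simp only [edgeClosureT, mem_closureT, eqT_val, decide_eq_true_eq]
  rfl

theorem reachT_val {Δ : List (Edge Loc Act)} {e f : Edge Loc Act} :
    (reachT (edgeClosureT Δ).val e f).val = true ↔ ReflTransGen (EdgeStep Δ) e f := by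
  simp only [reachT, orT_val, eqT_val, memT_val, mem_edgeClosureT, Bool.or_eq_true,
    decide_eq_true_eq, reflTransGen_iff_eq_or_transGen, @eq_comm _ e f]

@[simp] theorem depT_val {I : List (Act × Act)} {a b : Act} :
    (depT I a b).val = true ↔ (a, b) ∉ I := by
  simp [depT]

theorem progOrderT_val {G : CFG Loc Act} {a b : Act} :
    (progOrderT G.edges (edgeClosureT G.edges).val a b).val = true ↔ ProgOrder G a b := by
  simp only [progOrderT, anyT_val, List.any_eq_true, andT_val, Bool.and_eq_true, eqT_val,
    decide_eq_true_eq, reachT_val, progOrder_iff, edgeReach_iff]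
  constructor
  · rintro ⟨e, he, h, f, hf, h', h''⟩
    exact ⟨e, he, f, hf, h, h', h''⟩
  · rintro ⟨e, he, f, hf, h, h', h''⟩
    exact ⟨e, he, h, f, hf, h', h''⟩

theorem atRelT_val {blocks : List (Act × CFG Loc Act)} {a b : Act} :
    (atRelT (blocks.map fun B => (B.2.edges, (edgeClosureT B.2.edges).val)) a b).val = true ↔
      AtRel blocks a b := by
  simp only [atRelT, anyT_val, List.any_eq_true, andT_val, Bool.and_eq_true, eqT_val,
    decide_eq_true_eq, memT_val, atRel_iff, List.mem_map]
  constructor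
  · rintro ⟨_, ⟨B, hB, rfl⟩, e, he, h, f, hf, h', h''⟩
    exact ⟨B, hB, e, he, f, hf, h, h', mem_edgeClosureT.1 h''⟩
  · rintro ⟨B, hB, e, he, f, hf, h, h', h''⟩
    exact ⟨_, ⟨B, hB, rfl⟩, e, he, h, f, hf, h', mem_edgeClosureT.2 h''⟩

theorem mem_step1_actions {G : CFG Loc Act} {blocks : List (Act × CFG Loc Act)}
    {I : List (Act × Act)} {a : Act} : a ∈ (step1 G blocks I).val.1 ↔ a ∈ G.alphabet := by
  simp [step1, CFG.alphabet]

theorem mem_step1_chains {G : CFG Loc Act} {blocks : List (Act × CFG Loc Act)}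
    (hsub : ∀ B ∈ blocks, B.2.alphabet ⊆ G.alphabet) {I : List (Act × Act)} {a b : Act} :
    (a, b) ∈ (step1 G blocks I).val.2 ↔ Chain G blocks I a b := by
  simp only [step1, bind_val, mapT_val, pairsT_val, pure_val]
  set A := G.edges.map fun e => e.label with hA
  have hmemA : ∀ a, a ∈ A ↔ a ∈ G.alphabet := fun a => by simp [hA, CFG.alphabet]
  set R := (filterT (fun ab : Act × Act => orT
    (progOrderT G.edges (edgeClosureT G.edges).val ab.1 ab.2)
    (atRelT (blocks.map fun B => (B.2.edges, (edgeClosureT B.2.edges).val)) ab.1 ab.2))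
    (A ×ˢ A)).val with hR
  have hmemR : ∀ a b, (a, b) ∈ R ↔ Link G blocks a b := fun a b => by
    simp only [hR, filterT_val, List.mem_filter, orT_val, Bool.or_eq_true, progOrderT_val,
      atRelT_val, List.mem_product, hmemA]
    exact ⟨And.right, fun h => ⟨link_mem_alphabet hsub h, h⟩⟩
  have hT : ∀ a c, (a, c) ∈ (closureT A fun a c => anyT
      (fun b => andT (depT I a b) (memT (b, c) R)) A).val ↔
        TransGen (Comp (Dep G I) (Link G blocks)) a c := fun a c => by
    rw [mem_closureT]
    have : (fun x y => x ∈ A ∧ y ∈ A ∧ (anyT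
        (fun b => andT (depT I x b) (memT (b, y) R)) A).val = true) =
          Comp (Dep G I) (Link G blocks) := by
      funext x y
      simp only [anyT_val, List.any_eq_true, andT_val, Bool.and_eq_true, memT_val,
        decide_eq_true_eq, hmemR, hmemA, depT_val, eq_iff_iff, Comp, Dep]
      constructor
      · rintro ⟨hx, -, b, hb, h, h'⟩
        exact ⟨b, ⟨hx, hb, h⟩, h'⟩
      · rintro ⟨b, ⟨hx, hb, h⟩, h'⟩
        exact ⟨hx, (link_mem_alphabet hsub h').2, b, hb, h, h'⟩
    rw [this]
  simp only [filterT_val, List.mem_filter, orT_val, memT_val, anyT_val, andT_val, Bool.or_eq_true,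
    decide_eq_true_eq, List.any_eq_true, Bool.and_eq_true, hmemR, hT, List.mem_product, hmemA,
    Chain, Comp, reflTransGen_iff_eq_or_transGen]
  constructor
  · rintro ⟨-, h | ⟨c, -, h, h'⟩⟩
    · exact ⟨b, h, Or.inl rfl⟩
    · exact ⟨c, h, Or.inr h'⟩
  · rintro ⟨c, h, rfl | h'⟩
    · exact ⟨link_mem_alphabet hsub h, Or.inl h⟩
    · refine ⟨⟨(link_mem_alphabet hsub h).1, ?_⟩,
        Or.inr ⟨c, (link_mem_alphabet hsub h).2, h, h'⟩⟩
      obtain ⟨_, _, d, _, h⟩ := TransGen.tail'_iff.1 h'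
      exact (link_mem_alphabet hsub h).2

variable {B : CFG Loc Act}

/-- The set of the edges in a list, used to compare the listed components with the sets of edges of
the specification. -/
def edgeSet (l : List (Edge Loc Act)) : Set (Edge Loc Act) := {e | e ∈ l}

omit [DecidableEq Loc] [DecidableEq Act] in
theorem isSCC_eq_of_mem {S S' : Set (Edge Loc Act)} (hS : IsSCC B S) (hS' : IsSCC B S')
    {e : Edge Loc Act} (he : e ∈ S) (he' : e ∈ S') : S = S' := by
  obtain ⟨f, -, rfl⟩ := hS
  obtain ⟨f', -, rfl⟩ := hS'
  ext g
  constructor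
  · rintro ⟨h, h1, h2⟩
    exact ⟨h, he'.2.1.trans (he.2.2.trans h1), h2.trans (he.2.1.trans he'.2.2)⟩
  · rintro ⟨h, h1, h2⟩
    exact ⟨h, he.2.1.trans (he'.2.2.trans h1), h2.trans (he'.2.1.trans he.2.2)⟩

omit [DecidableEq Loc] [DecidableEq Act] in
theorem IsSCC.nonempty {S : Set (Edge Loc Act)} (hS : IsSCC B S) : S.Nonempty := by
  obtain ⟨f, hf, rfl⟩ := hS
  exact ⟨f, hf, .refl, .refl⟩

theorem isSCC_iff {S : Set (Edge Loc Act)} :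
    IsSCC B S ↔ ∃ l ∈ (step2 B.edges (edgeClosureT B.edges).val).val, edgeSet l = S := by
  have key : ∀ e, edgeSet (B.edges.filter fun f =>
      (andT (reachT (edgeClosureT B.edges).val e f) (reachT (edgeClosureT B.edges).val f e)).val) =
        {f | f ∈ B.edges ∧ EdgeReach B e f ∧ EdgeReach B f e} := fun e => by
    ext f
    simp only [edgeSet, List.mem_filter, andT_val, Bool.and_eq_true, reachT_val, Set.mem_ofPred_eq,
      edgeReach_iff]
  simp only [step2, mapT_val, filterT_val, List.mem_map, exists_exists_and_eq_and, key, IsSCC,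
    @eq_comm _ S]

theorem leT_val {S S' : List (Edge Loc Act)} :
    (leT (edgeClosureT B.edges).val S S').val = true ↔ SCCLe B (edgeSet S) (edgeSet S') := by
  simp [leT, List.any_eq_true, reachT_val, SCCLe, edgeSet, edgeReach_iff]

theorem sameT_val {S S' : List (Edge Loc Act)} (hS : IsSCC B (edgeSet S))
    (hS' : IsSCC B (edgeSet S')) : (sameT S S').val = true ↔ edgeSet S = edgeSet S' := by
  simp only [sameT, anyT_val, List.any_eq_true, memT_val, decide_eq_true_eq]
  constructor
  · rintro ⟨e, h, h'⟩
    exact isSCC_eq_of_mem hS hS' (e := e) h h'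
  · intro h
    obtain ⟨e, he⟩ := hS.nonempty
    exact ⟨e, he, (h ▸ he : e ∈ edgeSet S')⟩

theorem nontrivialT_val {S : List (Edge Loc Act)} :
    (nontrivialT S).val = true ↔ NontrivialSCC (edgeSet S) := by
  simp only [nontrivialT, anyT_val, List.any_eq_true, orT_val, eqT_val, notT_val, Bool.or_eq_true,
    decide_eq_true_eq, Bool.not_eq_true', decide_eq_false_iff_not, NontrivialSCC]
  constructor
  · rintro ⟨e, he, h | ⟨f, hf, h⟩⟩
    · by_cases hn : (edgeSet S).Nontrivial
      · exact Or.inl hn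
      · exact Or.inr ⟨e, (Set.not_nontrivial_iff.1 hn).eq_singleton_of_mem he, h⟩
    · exact Or.inl ⟨e, he, f, hf, h⟩
  · rintro (⟨e, he, f, hf, h⟩ | ⟨e, he, h⟩)
    · exact ⟨e, he, Or.inr ⟨f, hf, h⟩⟩
    · exact ⟨e, (he ▸ rfl : e ∈ edgeSet S), Or.inl h⟩

theorem mem_step3 {I : List (Act × Act)} {a : Act} {S : List (Edge Loc Act)} :
    S ∈ (step3 I (edgeClosureT B.edges).val
      (step2 B.edges (edgeClosureT B.edges).val).val a).val ↔
    S ∈ (step2 B.edges (edgeClosureT B.edges).val).val ∧ edgeSet S ∈ minSCC B I a := by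
  set sccs := (step2 B.edges (edgeClosureT B.edges).val).val with hsccs
  have hscc : ∀ S ∈ sccs, IsSCC B (edgeSet S) := fun S h => isSCC_iff.2 ⟨S, h, rfl⟩
  simp only [step3, bind_val, filterT_val, anyT_val, List.mem_filter, List.any_eq_true, depT_val,
    notT_val, Bool.not_eq_true', List.any_eq_false, andT_val, Bool.and_eq_true, leT_val,
    minSCC, Set.mem_ofPred_eq]
  constructor
  · rintro ⟨⟨hS, h⟩, hmin⟩
    refine ⟨hS, ⟨hscc S hS, h⟩, fun S' hS' h' hle => ?_⟩
    obtain ⟨l, hl, rfl⟩ := isSCC_iff.1 hS'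
    have := hmin l ⟨hl, h'⟩
    by_contra hne
    refine this ⟨hle, ?_⟩
    rw [← Bool.not_eq_true, sameT_val hS' (hscc S hS)]
    exact hne
  · rintro ⟨hS, ⟨-, h⟩, hmin⟩
    refine ⟨⟨hS, h⟩, ?_⟩
    rintro l ⟨hl, h'⟩ ⟨hle, hne⟩
    rw [← Bool.not_eq_true, sameT_val (hscc l hl) (hscc S hS)] at hne
    exact hne (hmin _ (hscc l hl) h' hle)

theorem mem_step4 {I : List (Act × Act)} {a : Act} {S : List (Edge Loc Act)} :
    S ∈ (step4 I (edgeClosureT B.edges).val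
      (step2 B.edges (edgeClosureT B.edges).val).val a).val ↔
    S ∈ (step2 B.edges (edgeClosureT B.edges).val).val ∧ edgeSet S ∈ maxSCC B I a := by
  set sccs := (step2 B.edges (edgeClosureT B.edges).val).val with hsccs
  have hscc : ∀ S ∈ sccs, IsSCC B (edgeSet S) := fun S h => isSCC_iff.2 ⟨S, h, rfl⟩
  simp only [step4, bind_val, filterT_val, anyT_val, List.mem_filter, List.any_eq_true, depT_val,
    notT_val, Bool.not_eq_true', List.any_eq_false, andT_val, Bool.and_eq_true, leT_val,
    maxSCC, Set.mem_ofPred_eq]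
  constructor
  · rintro ⟨⟨hS, h⟩, hmax⟩
    refine ⟨hS, ⟨hscc S hS, h⟩, fun S' hS' h' hle => ?_⟩
    obtain ⟨l, hl, rfl⟩ := isSCC_iff.1 hS'
    have := hmax l ⟨hl, h'⟩
    by_contra hne
    refine this ⟨hle, ?_⟩
    rw [← Bool.not_eq_true, sameT_val (hscc S hS) hS']
    exact fun h => hne h.symm
  · rintro ⟨hS, ⟨-, h⟩, hmax⟩
    refine ⟨⟨hS, h⟩, ?_⟩
    rintro l ⟨hl, h'⟩ ⟨hle, hne⟩
    rw [← Bool.not_eq_true, sameT_val (hscc S hS) (hscc l hl)] at hne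
    exact hne (hmax _ (hscc l hl) h' hle).symm

theorem algorithm_val_eq_false_iff {G : CFG Loc Act} {blocks : List (Act × CFG Loc Act)}
    (hsub : ∀ B ∈ blocks, B.2.alphabet ⊆ G.alphabet) {I : List (Act × Act)} :
    (algorithm G blocks I).val = false ↔ HasWitness G blocks I := by
  simp only [algorithm, bind_val, notT_val, anyT_val, Bool.not_eq_false', List.any_eq_true,
    HasWitness, checkBlock, step5, andT_val, orT_val, memT_val, Bool.and_eq_true,
    Bool.or_eq_true, decide_eq_true_eq, mem_step1_chains hsub, mapT_val, List.mem_map, pure_val,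
    exists_exists_and_eq_and, mem_step1_actions, leT_val, Bool.not_eq_true', nontrivialT_val,
    mem_step3, mem_step4]
  refine exists_congr fun B => and_congr_right fun hB => ?_
  constructor
  · rintro ⟨a, ha, b, hb, hab, S, ⟨hS, hmin⟩, S', ⟨hS', hmax⟩, hle, h⟩
    rw [← Bool.not_eq_true, sameT_val hmin.1.1 hmax.1.1] at h
    exact ⟨_, _, hmin.1.1, hmax.1.1, hle, fun he => h.resolve_left (not_not.2 he), a, ha, b, hb,
      hab, hmin, hmax⟩
  · rintro ⟨S, S', hS, hS', hle, h, a, ha, b, hb, hab, hmin, hmax⟩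
    obtain ⟨l, hl, rfl⟩ := isSCC_iff.1 hS
    obtain ⟨l', hl', rfl⟩ := isSCC_iff.1 hS'
    refine ⟨a, ha, b, hb, hab, l, ⟨hl, hmin⟩, l', ⟨hl', hmax⟩, hle, ?_⟩
    rw [← Bool.not_eq_true, sameT_val hS hS']
    exact or_iff_not_imp_left.2 fun he => h (not_not.1 he)

end Correctness

/-! ### Witnesses in terms of edges -/

section Witness

open Relation

variable {Loc Act : Type} {B : CFG Loc Act} {I : List (Act × Act)}

theorem exists_isSCC {e : Edge Loc Act} (he : e ∈ B.edges) : ∃ S, IsSCC B S ∧ e ∈ S :=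
  ⟨_, ⟨e, he, rfl⟩, he, .refl, .refl⟩

theorem IsSCC.mem_edges {S : Set (Edge Loc Act)} (hS : IsSCC B S) {e : Edge Loc Act} (he : e ∈ S) :
    e ∈ B.edges := by
  obtain ⟨f, -, rfl⟩ := hS
  exact he.1

theorem IsSCC.reach {S : Set (Edge Loc Act)} (hS : IsSCC B S) {e f : Edge Loc Act} (he : e ∈ S)
    (hf : f ∈ S) : EdgeReach B e f := by
  obtain ⟨g, -, rfl⟩ := hS
  exact he.2.2.trans hf.2.1

theorem SCCLe.trans {S₁ S₂ S₃ : Set (Edge Loc Act)} (h₂ : IsSCC B S₂) (h : SCCLe B S₁ S₂)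
    (h' : SCCLe B S₂ S₃) : SCCLe B S₁ S₃ := by
  obtain ⟨e, he, f, hf, h⟩ := h
  obtain ⟨e', he', f', hf', h'⟩ := h'
  exact ⟨e, he, f', hf', h.trans ((h₂.reach hf he').trans h')⟩

theorem SCCLe.antisymm {S₁ S₂ : Set (Edge Loc Act)} (h₁ : IsSCC B S₁) (h₂ : IsSCC B S₂)
    (h : SCCLe B S₁ S₂) (h' : SCCLe B S₂ S₁) : S₁ = S₂ := by
  obtain ⟨e, he, f, hf, h⟩ := h
  obtain ⟨e', he', f', hf', h'⟩ := h'
  obtain ⟨g, hg, rfl⟩ := id h₁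
  refine isSCC_eq_of_mem h₁ h₂ (e := f) ⟨h₂.mem_edges hf, he.2.1.trans h, ?_⟩ hf
  exact (h₂.reach hf he').trans (h'.trans hf'.2.2)

theorem finite_setOf_isSCC (B : CFG Loc Act) : {S | IsSCC B S}.Finite :=
  (B.edges.finite_toSet.finite_subsets).subset fun _ hS _ he => IsSCC.mem_edges hS he

/-- Below every component with a property there is a minimal one, and above it a maximal one: the
statement for a relation `R` that is `SCCLe` or its converse. -/
theorem exists_extremal_isSCC {R : Set (Edge Loc Act) → Set (Edge Loc Act) → Prop}
    (hrefl : ∀ S, IsSCC B S → R S S)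
    (htrans : ∀ S₁ S₂ S₃, IsSCC B S₂ → R S₁ S₂ → R S₂ S₃ → R S₁ S₃)
    (hanti : ∀ S₁ S₂, IsSCC B S₁ → IsSCC B S₂ → R S₁ S₂ → R S₂ S₁ → S₁ = S₂)
    {P : Set (Edge Loc Act) → Prop} {S : Set (Edge Loc Act)} (hS : IsSCC B S) (hP : P S) :
    ∃ S', IsSCC B S' ∧ P S' ∧ R S' S ∧ ∀ S'', IsSCC B S'' → P S'' → R S'' S' → S'' = S' := by
  have : Finite {S // IsSCC B S} := finite_setOf_isSCC B
  let r : {S // IsSCC B S} → {S // IsSCC B S} → Prop := fun S₁ S₂ => R S₁ S₂ ∧ S₁ ≠ S₂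
  have : IsTrans _ r := ⟨fun S₁ S₂ S₃ h h' => ⟨htrans _ _ _ S₂.2 h.1 h'.1, fun he => h.2 <|
    Subtype.ext (hanti _ _ S₁.2 S₂.2 h.1 (he ▸ h'.1))⟩⟩
  have : Std.Irrefl r := ⟨fun _ h => h.2 rfl⟩
  have hwf : WellFounded r := Finite.wellFounded_of_trans_of_irrefl r
  obtain ⟨S', ⟨h1, h2⟩, h3⟩ := hwf.has_min {S' | P S' ∧ R S' S} ⟨⟨S, hS⟩, hP, hrefl S hS⟩
  refine ⟨S', S'.2, h1, h2, fun S'' hS'' hP'' hR => ?_⟩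
  by_contra hne
  exact h3 ⟨S'', hS''⟩ ⟨hP'', htrans _ _ _ S'.2 hR h2⟩ ⟨hR, fun h => hne (congrArg Subtype.val h)⟩

/-- The components in a witness may be replaced by two edges, the second of which is reached from
the first by a path of at least two edges: minimal and maximal components only serve to limit the
search. -/
theorem hasWitness_iff {G : CFG Loc Act} {blocks : List (Act × CFG Loc Act)}
    (hsub : ∀ B ∈ blocks, B.2.alphabet ⊆ G.alphabet) :
    HasWitness G blocks I ↔ ∃ B ∈ blocks, ∃ e f, TransGen (EdgeStep B.2.edges) e f ∧
      ∃ a b, Chain G blocks I a b ∧ (e.label, a) ∉ I ∧ (b, f.label) ∉ I := by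
  constructor
  · rintro ⟨B, hB, S₁, S₂, hS₁, hS₂, hle, hnt, a, -, b, -, hab, ⟨⟨-, e, he, hea⟩, -⟩,
      ⟨⟨-, f, hf, hbf⟩, -⟩⟩
    refine ⟨B, hB, e, f, ?_, a, b, hab, hea, hbf⟩
    have hef : EdgeReach B.2 e f := by
      obtain ⟨e', he', f', hf', h⟩ := hle
      exact (hS₁.reach he he').trans (h.trans (hS₂.reach hf' hf))
    rcases reflTransGen_iff_eq_or_transGen.1 hef with rfl | h
    · have hS : S₁ = S₂ := isSCC_eq_of_mem hS₁ hS₂ he hf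
      rcases hnt hS with h | ⟨g, rfl, hg⟩
      · obtain ⟨g, hg, hne⟩ := h.exists_ne f
        have h1 := hS₁.reach he hg
        have h2 := hS₁.reach hg he
        rcases reflTransGen_iff_eq_or_transGen.1 h1 with rfl | h1
        · exact absurd rfl hne
        · exact TransGen.trans_left h1 h2
      · have hfg : f = g := he
        subst hfg
        exact .single ⟨hS₁.mem_edges he, hS₁.mem_edges he, hg⟩
    · exact h
  · rintro ⟨B, hB, e, f, hef, a, b, hab, hea, hbf⟩
    have he : e ∈ B.2.edges := by
      obtain ⟨_, h, -⟩ := TransGen.head'_iff.1 hef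
      exact h.1
    have hf : f ∈ B.2.edges := by
      obtain ⟨_, -, h⟩ := TransGen.tail'_iff.1 hef
      exact h.2.1
    obtain ⟨S, hS, heS⟩ := exists_isSCC he
    obtain ⟨T, hT, hfT⟩ := exists_isSCC hf
    have hrefl : ∀ S, IsSCC B.2 S → SCCLe B.2 S S := fun S hS => by
      obtain ⟨e, he⟩ := hS.nonempty
      exact ⟨e, he, e, he, .refl⟩
    obtain ⟨S₁, hS₁, hP₁, hle₁, hmin⟩ := exists_extremal_isSCC (R := SCCLe B.2)
      (P := fun S => ∃ e ∈ S, (e.label, a) ∉ I) hrefl (fun _ _ _ h => SCCLe.trans h)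
      (fun _ _ h h' => SCCLe.antisymm h h') hS ⟨e, heS, hea⟩
    obtain ⟨S₂, hS₂, hP₂, hle₂, hmax⟩ := exists_extremal_isSCC
      (R := fun S S' => SCCLe B.2 S' S)
      (P := fun S => ∃ e ∈ S, (b, e.label) ∉ I) hrefl (fun _ _ _ h h1 h2 => SCCLe.trans h h2 h1)
      (fun _ _ h h' h1 h2 => SCCLe.antisymm h h' h2 h1) hT ⟨f, hfT, hbf⟩
    have hST : SCCLe B.2 S T := ⟨e, heS, f, hfT, hef.to_reflTransGen⟩
    have hST₂ : SCCLe B.2 S S₂ := SCCLe.trans hT hST hle₂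
    obtain ⟨c, hac, hcb⟩ := id hab
    have ha := (link_mem_alphabet hsub hac).1
    have hb : b ∈ G.alphabet := by
      rcases reflTransGen_iff_eq_or_transGen.1 hcb with rfl | h
      · exact (link_mem_alphabet hsub hac).2
      · obtain ⟨_, _, _, _, h⟩ := TransGen.tail'_iff.1 h
        exact (link_mem_alphabet hsub h).2
    refine ⟨B, hB, S₁, S₂, hS₁, hS₂, SCCLe.trans hS hle₁ hST₂, ?_, a, ha, b, hb, hab,
      ⟨⟨hS₁, hP₁⟩, hmin⟩, ⟨⟨hS₂, hP₂⟩, hmax⟩⟩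
    rintro rfl
    -- All components between the two are equal, so that `e` and `f` lie on a common cycle.
    have h1 : S₁ = S := SCCLe.antisymm hS₁ hS hle₁ hST₂
    subst h1
    have hfe : EdgeReach B.2 f e := by
      obtain ⟨g, hg, g', hg', h⟩ := hle₂
      exact (hT.reach hfT hg).trans (h.trans (hS.reach hg' heS))
    obtain ⟨g, heg, hgf⟩ := TransGen.head'_iff.1 hef
    by_cases hge : g = e
    · subst hge
      by_cases hn : S₁.Nontrivial
      · exact Or.inl hn
      · exact Or.inr ⟨g, (Set.not_nontrivial_iff.1 hn).eq_singleton_of_mem heS, heg.2.2⟩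
    · refine Or.inl ⟨e, heS, g, ?_, fun h => hge h.symm⟩
      obtain ⟨e', -, rfl⟩ := id hS
      exact ⟨heg.2.1, heS.2.1.trans (.single heg), (hgf.trans hfe).trans heS.2.2⟩

end Witness

/-! ### Local traces -/

section LocalTrace

variable {Act : Type}

@[simp] theorem localTrace_nil (i : ℕ) : localTrace ([] : List (Act × ℕ)) i = [] := rfl

@[simp] theorem localTrace_append (τ τ' : List (Act × ℕ)) (i : ℕ) :
    localTrace (τ ++ τ') i = localTrace τ i ++ localTrace τ' i := by
  simp [localTrace]

theorem localTrace_cons (a : Act) (j : ℕ) (τ : List (Act × ℕ)) (i : ℕ) :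
    localTrace ((a, j) :: τ) i = if j = i then a :: localTrace τ i else localTrace τ i := by
  by_cases h : j = i <;> simp [localTrace, h]

@[simp] theorem localTrace_map (u : List Act) (j i : ℕ) :
    localTrace (u.map fun a => (a, j)) i = if j = i then u else [] := by
  induction u with
  | nil => simp
  | cons a u ih =>
    rw [List.map_cons, localTrace_cons, ih]
    split_ifs <;> rfl

theorem Swap.localTrace_eq {I : List (Act × Act)} {τ τ' : List (Act × ℕ)} (h : Swap I τ τ')
    (i : ℕ) : localTrace τ' i = localTrace τ i := by
  obtain ⟨ρ, σ, a, b, j, k, -, hjk, rfl, rfl⟩ := h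
  simp only [localTrace_append, localTrace_cons, localTrace_nil]
  split_ifs <;> simp_all

theorem CoveredBy.localTrace_eq {I : List (Act × Act)} {τ τ' : List (Act × ℕ)}
    (h : CoveredBy I τ τ') (i : ℕ) : localTrace τ' i = localTrace τ i := by
  induction h with
  | refl => rfl
  | tail _ h ih => rw [h.localTrace_eq, ih]

end LocalTrace

/-! ### Atomic fusions -/

namespace AtomicFusion

variable {Loc Act : Type} {G : CFG Loc Act} (F : AtomicFusion G)

theorem mem_prod_nil {X Y : Type} {μ : X → Language Y} {v : List Y} :
    v ∈ (([] : List X).map μ).prod ↔ v = [] := by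
  simp

theorem mem_prod_cons {X Y : Type} {μ : X → Language Y} {x : X} {w : List X} {v : List Y} :
    v ∈ ((x :: w).map μ).prod ↔ ∃ u ∈ μ x, ∃ v' ∈ (w.map μ).prod, u ++ v' = v := by
  simp [Language.mem_mul]

theorem morphism_of_mem {B : Act × CFG Loc Act} (hB : B ∈ F.blocks) {u : List Act} :
    u ∈ F.morphism B.1 ↔ u ∈ B.2.traces := by
  constructor
  · rintro (⟨B', hB', h, hu⟩ | ⟨h, -⟩)
    · rwa [← List.inj_on_of_nodup_map F.symbols_nodup hB' hB h]
    · exact absurd rfl (h B hB)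
  · exact fun hu => Or.inl ⟨B, hB, rfl, hu⟩

theorem morphism_of_notMem {a : Act} (ha : a ∉ F.blocks.map Prod.fst) {u : List Act} :
    u ∈ F.morphism a ↔ u = [a] := by
  constructor
  · rintro (⟨B', hB', rfl, hu⟩ | ⟨h, hu⟩)
    · exact absurd (List.mem_map_of_mem hB') ha
    · exact hu
  · exact fun hu => Or.inr ⟨fun B hB h => ha (h ▸ List.mem_map_of_mem hB), hu⟩

theorem ne_nil_of_mem_morphism {a : Act} {u : List Act} (hu : u ∈ F.morphism a) : u ≠ [] := by
  rintro rfl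
  rcases hu with ⟨B, -, -, h⟩ | ⟨-, h⟩
  · exact B.2.init_ne_exit (run_nil_iff.1 h)
  · exact absurd h (by simp)

/-- The edge of `G` that stems from the edge `f` of the body of the block `β`. -/
def embed (ρ : Act → Loc → Loc) (β : Act) (f : Edge Loc Act) : Edge Loc Act :=
  (ρ β f.src, f.label, ρ β f.tgt)

section Insertion

variable {F} {ρ : Act → Loc → Loc} (hρ : IsInsertion G F.outer F.blocks ρ)
include hρ

theorem mem_edges_iff {g : Edge Loc Act} : g ∈ G.edges ↔
    (g ∈ F.outer.edges ∧ g.label ∉ F.blocks.map Prod.fst) ∨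
      ∃ B ∈ F.blocks, ∃ f ∈ B.2.edges, embed ρ B.1 f = g := by
  rw [hρ.edges_perm.mem_iff]
  simp only [List.mem_append, List.mem_filter, decide_eq_true_eq, List.mem_flatMap, List.mem_map,
    embed]

theorem embed_mem {B : Act × CFG Loc Act} (hB : B ∈ F.blocks) {f : Edge Loc Act}
    (hf : f ∈ B.2.edges) : embed ρ B.1 f ∈ G.edges :=
  (mem_edges_iff hρ).2 (Or.inr ⟨B, hB, f, hf, rfl⟩)

open Classical in
theorem nodup_labels_insertion :
    ((F.outer.edges.filter (fun e => e.label ∉ F.blocks.map Prod.fst)).map Edge.label ++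
      F.blocks.flatMap fun B => B.2.edges.map Edge.label).Nodup := by
  have h := (hρ.edges_perm.map Edge.label).nodup_iff.1 G.labels_nodup
  rw [List.map_append, List.map_flatMap] at h
  simp only [List.map_map] at h
  exact h

theorem block_unique {B B' : Act × CFG Loc Act} (hB : B ∈ F.blocks) (hB' : B' ∈ F.blocks)
    {f f' : Edge Loc Act} (hf : f ∈ B.2.edges) (hf' : f' ∈ B'.2.edges)
    (h : f.label = f'.label) : B = B' := by
  by_contra hne
  have h1 := (List.nodup_flatMap.1 (List.nodup_append.1 (nodup_labels_insertion hρ)).2.1).2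
  have : Std.Symm (Function.onFun List.Disjoint fun B : Act × CFG Loc Act =>
    B.2.edges.map Edge.label) := ⟨fun _ _ h => List.Disjoint.symm h⟩
  have h2 : List.Disjoint (B.2.edges.map Edge.label) (B'.2.edges.map Edge.label) :=
    h1.forall hB hB' hne
  exact h2 (List.mem_map_of_mem hf) (h ▸ List.mem_map_of_mem hf')

theorem outer_label_ne {g : Edge Loc Act} (hg : g ∈ F.outer.edges)
    (hl : g.label ∉ F.blocks.map Prod.fst) {B : Act × CFG Loc Act} (hB : B ∈ F.blocks)
    {f : Edge Loc Act} (hf : f ∈ B.2.edges) : g.label ≠ f.label := by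
  refine (List.nodup_append.1 (nodup_labels_insertion hρ)).2.2 _ ?_ _ ?_
  · exact List.mem_map_of_mem (List.mem_filter.2 ⟨hg, by simpa using hl⟩)
  · exact List.mem_flatMap.2 ⟨B, hB, List.mem_map_of_mem hf⟩

/-- A trace of the body of a block runs from the source to the target of the edge it replaces. -/
theorem run_embed {B : Act × CFG Loc Act} (hB : B ∈ F.blocks) {ℓ ℓ' : Loc} {u : List Act}
    (h : Run B.2.edges ℓ u ℓ') : Run G.edges (ρ B.1 ℓ) u (ρ B.1 ℓ') := by
  induction h with
  | nil => exact .nil _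
  | cons hf _ ih => exact .cons (embed_mem hρ hB hf) ih

theorem run_of_mem_prod {ℓ ℓ' : Loc} {x v : List Act} (h : Run F.outer.edges ℓ x ℓ')
    (hv : v ∈ (x.map F.morphism).prod) : Run G.edges ℓ v ℓ' := by
  induction h generalizing v with
  | nil =>
    obtain rfl := mem_prod_nil.1 hv
    exact .nil _
  | @cons ℓ ℓ₁ ℓ₂ a τ he _ ih =>
    obtain ⟨u, hu, v', hv', rfl⟩ := mem_prod_cons.1 hv
    refine Run.append ?_ (ih hv')
    by_cases ha : a ∈ F.blocks.map Prod.fst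
    · obtain ⟨B, hB, rfl⟩ := List.mem_map.1 ha
      have h := run_embed hρ hB ((F.morphism_of_mem hB).1 hu)
      rwa [hρ.entry B hB _ he rfl, hρ.leave B hB _ he rfl] at h
    · obtain rfl := (F.morphism_of_notMem ha).1 hu
      exact Run.single ((mem_edges_iff hρ).2 (Or.inl ⟨he, ha⟩))

/-- A location of a block that is merged with a location of the outer graph is the initial or the
exit location of the block. -/
theorem eq_init_or_exit {B : Act × CFG Loc Act} (hB : B ∈ F.blocks) {b : Loc} (hb : b ∈ B.2.locs)
    (h : ρ B.1 b ∈ F.outer.locs) : b = B.2.init ∨ b = B.2.exit := by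
  by_contra hc
  rw [not_or] at hc
  exact hρ.fresh B hB b hb hc.1 hc.2 h

/-- After an edge `d` of `G` that does not come from the body of `B`, a run that stands at a
location of the outer graph can enter the body of `B` only through its initial location. -/
theorem src_eq_init {B : Act × CFG Loc Act} (hB : B ∈ F.blocks) {f : Edge Loc Act}
    (hf : f ∈ B.2.edges) (hout : ρ B.1 f.src ∈ F.outer.locs) {d : Edge Loc Act} (hd : d ∈ G.edges)
    (htgt : d.tgt = ρ B.1 f.src)
    (hne : ∀ f' ∈ B.2.edges, f'.tgt = f.src → f'.label ≠ d.label) : f.src = B.2.init := by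
  rcases eq_init_or_exit hρ hB (B.2.src_mem _ hf) hout with h | h
  · exact h
  · obtain ⟨f', hf', h1, h2⟩ := (hρ.reentry_exit B hB ⟨f, hf, h⟩).2 d hd (by rw [htgt, h])
    exact absurd h2 (hne f' hf' (h1.trans h.symm))

/-- A run of `G` to the exit location is cut into traces of blocks and single edges of the outer
graph. The first part is about a run that starts at a location of the outer graph and does not start
in the middle of a block. The second part is about a run that starts inside the block `B`, at the
location `b` reached by an edge of `B`. -/
theorem exists_parse_aux (w : List Act) :
    (∀ ℓ ∈ F.outer.locs, Run G.edges ℓ w G.exit →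
      (∀ B ∈ F.blocks, ∀ f ∈ B.2.edges, w.head? = some f.label → f.src = B.2.init) →
      ∃ ps : List (Act × List Act), (∀ p ∈ ps, p.2 ∈ F.morphism p.1) ∧
        ps.flatMap Prod.snd = w ∧ Run F.outer.edges ℓ (ps.map Prod.fst) G.exit) ∧
    (∀ B ∈ F.blocks, ∀ e ∈ F.outer.edges, e.label = B.1 → ∀ d ∈ B.2.edges,
      Run G.edges (ρ B.1 d.tgt) w G.exit →
      ∃ u, Run B.2.edges d.tgt u B.2.exit ∧
      ∃ ps : List (Act × List Act), (∀ p ∈ ps, p.2 ∈ F.morphism p.1) ∧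
        u ++ ps.flatMap Prod.snd = w ∧ Run F.outer.edges e.tgt (ps.map Prod.fst) G.exit) := by
  have hexit : G.exit ∈ F.outer.locs := hρ.exit_eq ▸ F.outer.exit_mem
  induction w with
  | nil =>
    constructor
    · intro ℓ _ h _
      exact ⟨[], by simp, rfl, run_nil_iff.1 h ▸ .nil _⟩
    · intro B hB e he hl d hd h
      have h1 := run_nil_iff.1 h
      have hb : d.tgt = B.2.exit := by
        refine (eq_init_or_exit hρ hB (B.2.tgt_mem _ hd) (h1 ▸ hexit)).resolve_left fun h2 => ?_
        exact (hρ.reentry_init B hB ⟨d, hd, h2⟩).1 (h2 ▸ h1)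
      refine ⟨[], run_nil_iff.2 hb, [], by simp, rfl, ?_⟩
      exact run_nil_iff.2 (by rw [← hρ.leave B hB e he hl, ← hb, h1])
  | cons a w ih =>
    have part₁ : ∀ ℓ ∈ F.outer.locs, Run G.edges ℓ (a :: w) G.exit →
        (∀ B ∈ F.blocks, ∀ f ∈ B.2.edges, (a :: w).head? = some f.label → f.src = B.2.init) →
        ∃ ps : List (Act × List Act), (∀ p ∈ ps, p.2 ∈ F.morphism p.1) ∧
          ps.flatMap Prod.snd = a :: w ∧ Run F.outer.edges ℓ (ps.map Prod.fst) G.exit := by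
      intro ℓ hℓ h hhead
      obtain ⟨ℓ₁, hg, hw⟩ := run_cons_iff.1 h
      rcases (mem_edges_iff hρ).1 hg with ⟨hgo, hga⟩ | ⟨B, hB, f, hf, hfg⟩
      · obtain ⟨ps, h1, h2, h3⟩ := ih.1 ℓ₁ (F.outer.tgt_mem _ hgo) hw (by
          intro B hB f hf hf'
          cases w with
          | nil => simp at hf'
          | cons c w =>
            obtain rfl : c = f.label := by simpa using hf'
            obtain ⟨ℓ₂, hk, -⟩ := run_cons_iff.1 hw
            have hk' := CFG.edge_ext hk (embed_mem hρ hB hf) rfl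
            have hsrc : ℓ₁ = ρ B.1 f.src := congrArg Edge.src hk'
            exact src_eq_init hρ hB hf (hsrc ▸ F.outer.tgt_mem _ hgo) hg hsrc
              fun f' hf' _ h => outer_label_ne hρ hgo hga hB hf' h.symm)
        refine ⟨(a, [a]) :: ps, ?_, by simp [h2], .cons hgo h3⟩
        rintro p (_ | ⟨_, hp⟩)
        · exact (F.morphism_of_notMem hga).2 rfl
        · exact h1 p hp
      · have hsrc : ρ B.1 f.src = ℓ := congrArg Edge.src hfg
        have hlab : f.label = a := congrArg Edge.label hfg
        have htgt : ρ B.1 f.tgt = ℓ₁ := congrArg Edge.tgt hfg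
        have hinit := hhead B hB f hf (by simp [hlab])
        obtain ⟨e, he, hel⟩ := F.symbols_mem B hB
        obtain ⟨u, hu, ps, h1, h2, h3⟩ := ih.2 B hB e he hel f hf (htgt ▸ hw)
        refine ⟨(B.1, a :: u) :: ps, ?_, by simp [h2], ?_⟩
        · rintro p (_ | ⟨_, hp⟩)
          · refine (F.morphism_of_mem hB).2 ?_
            exact .cons (ℓ₁ := f.tgt) (by rw [← hinit, ← hlab]; exact hf) hu
          · exact h1 p hp
        · refine .cons (ℓ₁ := e.tgt) ?_ h3
          rw [← hsrc, hinit, hρ.entry B hB e he hel, ← hel]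
          exact he
    refine ⟨part₁, ?_⟩
    intro B hB e he hel d hd h
    obtain ⟨ℓ₁, hg, hw⟩ := run_cons_iff.1 h
    by_cases hcont : ∃ f ∈ B.2.edges, f.src = d.tgt ∧ f.label = a
    · obtain ⟨f, hf, hsrc, hlab⟩ := hcont
      have hfg := CFG.edge_ext (embed_mem hρ hB hf) hg hlab
      have htgt : ρ B.1 f.tgt = ℓ₁ := congrArg Edge.tgt hfg
      obtain ⟨u, hu, ps, h1, h2, h3⟩ := ih.2 B hB e he hel f hf (htgt ▸ hw)
      refine ⟨a :: u, .cons (ℓ₁ := f.tgt) ?_ hu, ps, h1, by simp [h2], h3⟩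
      rw [← hsrc, ← hlab]
      exact hf
    · -- The run leaves the block, so that it stands at the exit location of the block.
      have hb : d.tgt = B.2.exit := by
        by_contra hne
        by_cases hi : d.tgt = B.2.init
        · obtain ⟨f, hf, h1, h2⟩ := (hρ.reentry_init B hB ⟨d, hd, hi⟩).2 _ hg (by rw [← hi])
          exact hcont ⟨f, hf, h1.trans hi.symm, h2⟩
        · have hfresh := hρ.fresh B hB _ (B.2.tgt_mem _ hd) hi hne
          rcases (mem_edges_iff hρ).1 hg with ⟨hgo, -⟩ | ⟨B', hB', f, hf, hfg⟩
          · exact hfresh (F.outer.src_mem _ hgo)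
          · have hsrc : ρ B'.1 f.src = ρ B.1 d.tgt := congrArg Edge.src hfg
            obtain ⟨e', he', hel'⟩ := F.symbols_mem B' hB'
            obtain ⟨h1, h2⟩ := hρ.inj B' hB' B hB _ (B'.2.src_mem _ hf) _ (B.2.tgt_mem _ hd)
              (fun h => hfresh (by
                rw [← hsrc, h, hρ.entry B' hB' e' he' hel']; exact F.outer.src_mem _ he'))
              (fun h => hfresh (by
                rw [← hsrc, h, hρ.leave B' hB' e' he' hel']; exact F.outer.tgt_mem _ he'))
              hi hne hsrc
            obtain rfl := List.inj_on_of_nodup_map F.symbols_nodup hB' hB h1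
            exact hcont ⟨f, hf, h2, congrArg Edge.label hfg⟩
      have hloc : ρ B.1 d.tgt = e.tgt := by rw [hb, hρ.leave B hB e he hel]
      have hout : ρ B.1 d.tgt ∈ F.outer.locs := hloc ▸ F.outer.tgt_mem _ he
      obtain ⟨ps, h1, h2, h3⟩ := part₁ _ hout h (by
        intro B' hB' f hf hf'
        obtain rfl : a = f.label := by simpa using hf'
        have hfg := CFG.edge_ext hg (embed_mem hρ hB' hf) rfl
        have hsrc : ρ B.1 d.tgt = ρ B'.1 f.src := congrArg Edge.src hfg
        refine src_eq_init hρ hB' hf (hsrc ▸ hout) (embed_mem hρ hB hd) hsrc ?_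
        intro f' hf' htgt hlab
        obtain rfl := block_unique hρ hB' hB hf' hd hlab
        obtain rfl := CFG.edge_ext hf' hd hlab
        exact hcont ⟨f, hf, htgt.symm, rfl⟩)
      exact ⟨[], run_nil_iff.2 hb, ps, h1, h2, hloc ▸ h3⟩

end Insertion

theorem blocks_alphabet_subset : ∀ B ∈ F.blocks, B.2.alphabet ⊆ G.alphabet := by
  obtain ⟨ρ, hρ⟩ := F.insertion
  rintro B hB _ ⟨f, hf, rfl⟩
  exact ⟨_, embed_mem hρ hB hf, rfl⟩

/-- Every trace of `G` arises from a trace of the outer graph by replacing actions as prescribed by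
the fusion morphism. -/
theorem exists_parse {w : List Act} (hw : w ∈ G.traces) :
    ∃ ps : List (Act × List Act), (∀ p ∈ ps, p.2 ∈ F.morphism p.1) ∧
      ps.flatMap Prod.snd = w ∧ ps.map Prod.fst ∈ F.outer.traces := by
  obtain ⟨ρ, hρ⟩ := F.insertion
  obtain ⟨ps, h1, h2, h3⟩ := (exists_parse_aux hρ w).1 G.init (hρ.init_eq ▸ F.outer.init_mem) hw (by
    intro B hB f hf hf'
    cases w with
    | nil => simp at hf'
    | cons a w =>
      obtain rfl : a = f.label := by simpa using hf'
      obtain ⟨ℓ₁, hg, -⟩ := run_cons_iff.1 (show Run _ _ _ _ from hw)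
      have hfg := CFG.edge_ext hg (embed_mem hρ hB hf) rfl
      have hsrc : G.init = ρ B.1 f.src := congrArg Edge.src hfg
      refine (eq_init_or_exit hρ hB (B.2.src_mem _ hf)
        (hsrc ▸ hρ.init_eq ▸ F.outer.init_mem)).resolve_right fun h => ?_
      exact (hρ.reentry_exit B hB ⟨f, hf, h⟩).1 (by rw [← h, ← hsrc]))
  refine ⟨ps, h1, h2, ?_⟩
  rwa [hρ.init_eq, hρ.exit_eq] at h3

theorem localTrace_mem_prod {w : List (Act × ℕ)} {v : List (Act × ℕ)}
    (hv : v ∈ (w.map (liftIdx F.morphism)).prod) (i : ℕ) :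
    localTrace v i ∈ ((localTrace w i).map F.morphism).prod := by
  induction w generalizing v with
  | nil =>
    obtain rfl := mem_prod_nil.1 hv
    simp
  | cons x w ih =>
    obtain ⟨a, j⟩ := x
    obtain ⟨_, ⟨u, hu, rfl⟩, v', hv', rfl⟩ := mem_prod_cons.1 hv
    rw [localTrace_append, localTrace_cons, localTrace_map]
    by_cases h : j = i
    · simp only [h, if_true]
      exact mem_prod_cons.2 ⟨u, hu, _, ih hv', rfl⟩
    · simpa [h] using ih hv'

/-- Fused interleavings are interleavings of `G`. -/
theorem fused_subset {v : List (Act × ℕ)}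
    (hv : v ∈ extend (liftIdx F.morphism) (interleavings F.outer)) : v ∈ interleavings G := by
  obtain ⟨ρ, hρ⟩ := F.insertion
  obtain ⟨w, hw, hv⟩ := hv
  intro i
  have h := F.localTrace_mem_prod hv i
  rcases hw i with h1 | h1
  · left
    have := run_of_mem_prod hρ h1 h
    rwa [← hρ.init_eq, ← hρ.exit_eq] at this
  · right
    rw [h1] at h
    exact mem_prod_nil.1 h

end AtomicFusion

/-! ### Order of events under the covering preorder -/

section Before

variable {Act : Type} {I : List (Act × Act)}

/-- In the word `τ`, the `k`-th action of thread `i` comes before the `l`-th action of thread `j`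
(counting from zero): every prefix of `τ` that contains the latter contains the former. -/
def Before (τ : List (Act × ℕ)) (i k j l : ℕ) : Prop :=
  ∀ α β, τ = α ++ β → l < (localTrace α j).length → k < (localTrace α i).length

theorem before_append {τ τ' : List (Act × ℕ)} {i k j l : ℕ} (hk : k < (localTrace τ i).length)
    (hl : (localTrace τ j).length ≤ l) : Before (τ ++ τ') i k j l := by
  intro α β h hα
  rcases List.append_eq_append_iff.1 h with ⟨as, rfl, -⟩ | ⟨bs, rfl, -⟩
  · simp only [localTrace_append, List.length_append]
    omega
  · simp only [localTrace_append, List.length_append] at hl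
    omega

/-- A swap keeps the order of two actions that it is not allowed to exchange. -/
theorem Before.swap {τ τ' : List (Act × ℕ)} {i k j l : ℕ} {a b : Act} (h : Before τ i k j l)
    (hij : i ≠ j) (ha : (localTrace τ i)[k]? = some a) (hb : (localTrace τ j)[l]? = some b)
    (hab : (a, b) ∉ I) (hs : Swap I τ τ') : Before τ' i k j l := by
  obtain ⟨ρ, σ, c, d, m, n, hcd, hmn, rfl, rfl⟩ := hs
  intro α β hαβ hl
  rw [List.append_assoc] at hαβ
  rcases List.append_eq_append_iff.1 hαβ with ⟨as, rfl, has⟩ | ⟨bs, rfl, -⟩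
  · rcases as with _ | ⟨x, _ | ⟨y, as⟩⟩
    · exact h _ ([(c, m), (d, n)] ++ σ) (by simp) hl
    · -- The prefix ends between the two exchanged actions.
      obtain rfl : (d, n) = x := by simpa using (List.cons.inj has).1
      have h1 := h ρ ([(c, m), (d, n)] ++ σ) (by simp)
      have h2 := h (ρ ++ [(c, m), (d, n)]) σ (by simp)
      by_cases hlρ : l < (localTrace ρ j).length
      · have := h1 hlρ
        simp only [localTrace_append, List.length_append]
        omega
      · by_cases hnj : n = j
        · subst hnj
          have hlen : l = (localTrace ρ n).length := by
            simp [localTrace_cons] at hl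
            omega
          obtain rfl : d = b := by
            simpa [localTrace_cons, hlen, hmn] using hb
          have h3 := h2 (by simp [localTrace_cons, hlen, hmn])
          by_contra hk
          have hkρ : ¬ k < (localTrace ρ i).length := by
            simp only [localTrace_append, List.length_append] at hk
            omega
          by_cases hmi : m = i
          · subst hmi
            have hlen' : k = (localTrace ρ m).length := by
              simp [localTrace_cons, hmn.symm] at h3
              omega
            obtain rfl : c = a := by
              simpa [localTrace_cons, hlen'] using ha
            exact hab hcd
          · simp [localTrace_cons, hmi, Ne.symm hij] at h3
            exact hkρ h3
        · simp [localTrace_cons, hnj] at hl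
          exact absurd hl hlρ
    · obtain ⟨rfl, rfl, -⟩ : (d, n) = x ∧ (c, m) = y ∧ σ = as ++ β := by simpa using has
      have hperm : ∀ p, (localTrace (ρ ++ (c, m) :: (d, n) :: as) p) =
          localTrace (ρ ++ (d, n) :: (c, m) :: as) p := fun p =>
        (Swap.localTrace_eq ⟨ρ, as, c, d, m, n, hcd, hmn, by simp, by simp⟩ p :
          localTrace (ρ ++ (d, n) :: (c, m) :: as) p = _).symm
      have hσ : σ = as ++ β := by simpa using has
      have := h (ρ ++ (c, m) :: (d, n) :: as) β (by simp [hσ])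
      rw [hperm, hperm] at this
      exact this hl
  · exact h α (bs ++ ([(c, m), (d, n)] ++ σ)) (by simp) hl

theorem Before.coveredBy {τ τ' : List (Act × ℕ)} {i k j l : ℕ} {a b : Act} (h : Before τ i k j l)
    (hij : i ≠ j) (ha : (localTrace τ i)[k]? = some a) (hb : (localTrace τ j)[l]? = some b)
    (hab : (a, b) ∉ I) (hs : CoveredBy I τ τ') : Before τ' i k j l := by
  induction hs with
  | refl => exact h
  | tail h1 h2 ih =>
    refine ih.swap hij ?_ ?_ hab h2
    · rw [CoveredBy.localTrace_eq h1, ha]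
    · rw [CoveredBy.localTrace_eq h1, hb]

theorem exists_cut {τ : List (Act × ℕ)} {i : ℕ} {p r : List Act} {a : Act}
    (h : localTrace τ i = p ++ a :: r) :
    ∃ α β, τ = α ++ (a, i) :: β ∧ localTrace α i = p ∧ localTrace β i = r := by
  induction τ generalizing p with
  | nil => simp at h
  | cons x τ ih =>
    obtain ⟨c, j⟩ := x
    rw [localTrace_cons] at h
    by_cases hj : j = i
    · subst hj
      rw [if_pos rfl] at h
      cases p with
      | nil =>
        obtain ⟨rfl, h'⟩ := List.cons.inj h
        exact ⟨[], τ, rfl, rfl, h'⟩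
      | cons b p =>
        obtain ⟨rfl, h'⟩ := List.cons.inj h
        obtain ⟨α, β, rfl, h1, h2⟩ := ih h'
        exact ⟨(c, j) :: α, β, rfl, by rw [localTrace_cons, if_pos rfl, h1], h2⟩
    · rw [if_neg hj] at h
      obtain ⟨α, β, rfl, h1, h2⟩ := ih h
      exact ⟨(c, j) :: α, β, rfl, by rw [localTrace_cons, if_neg hj, h1], h2⟩

end Before

/-! ### Blocks are contiguous in fused interleavings -/

namespace AtomicFusion

variable {Loc Act : Type} {G : CFG Loc Act} (F : AtomicFusion G)

/-- Edges labelled `a` and `b` follow each other inside the body of a block. -/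
def Linked (a b : Act) : Prop :=
  ∃ B ∈ F.blocks, ∃ e f, EdgeStep B.2.edges e f ∧ e.label = a ∧ f.label = b

/-- The fused interleavings, in which the blocks are executed atomically. -/
def fused : Language (Act × ℕ) := extend (liftIdx F.morphism) (interleavings F.outer)

theorem mem_prod_split {X Y : Type} {μ : X → Language Y} {w : List X} {α β : List Y} {x : Y}
    (h : α ++ x :: β ∈ (w.map μ).prod) : ∃ w₁ o w₂, w = w₁ ++ o :: w₂ ∧ ∃ v₁ v' v'' v₂,
      α = v₁ ++ v' ∧ β = v'' ++ v₂ ∧ v₁ ∈ (w₁.map μ).prod ∧ v' ++ x :: v'' ∈ μ o ∧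
      v₂ ∈ (w₂.map μ).prod := by
  induction w generalizing α with
  | nil => simp at h
  | cons o w ih =>
    obtain ⟨u, hu, v, hv, h⟩ := mem_prod_cons.1 h
    rcases List.append_eq_append_iff.1 h with ⟨as, rfl, has⟩ | ⟨bs, rfl, hbs⟩
    · subst has
      obtain ⟨w₁, o', w₂, rfl, v₁, v', v'', v₂, rfl, rfl, h1, h2, h3⟩ := ih hv
      exact ⟨o :: w₁, o', w₂, rfl, u ++ v₁, v', v'', v₂, by simp, rfl,
        mem_prod_cons.2 ⟨u, hu, v₁, h1, rfl⟩, h2, h3⟩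
    · rcases bs with _ | ⟨y, bs⟩
      · simp only [List.append_nil, List.nil_append] at hu hbs
        obtain ⟨w₁, o', w₂, rfl, v₁, v', v'', v₂, h0, rfl, h1, h2, h3⟩ :=
          ih (α := []) (by simpa [hbs] using hv)
        obtain ⟨rfl, rfl⟩ := List.append_eq_nil_iff.1 h0.symm
        exact ⟨o :: w₁, o', w₂, rfl, α, [], v'', v₂, by simp, rfl,
          mem_prod_cons.2 ⟨α, hu, [], h1, by simp⟩, h2, h3⟩
      · obtain ⟨rfl, rfl⟩ := List.cons.inj hbs
        exact ⟨[], o, w, rfl, [], α, bs, v, rfl, rfl, mem_prod_nil.2 rfl, hu, hv⟩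

theorem exists_getLast?_of_mem_prod {X Y : Type} {μ : X → Language Y} {w : List X} {v : List Y}
    (h : v ∈ (w.map μ).prod) {y : Y} (hy : v.getLast? = some y) :
    ∃ o ∈ w, ∃ u ∈ μ o, u.getLast? = some y := by
  obtain ⟨α, rfl⟩ := List.getLast?_eq_some_iff.1 hy
  clear hy
  induction w generalizing α with
  | nil => simp at h
  | cons o w ih =>
    obtain ⟨u, hu, v, hv, h⟩ := mem_prod_cons.1 h
    rcases List.eq_nil_or_concat v with rfl | ⟨v, z, rfl⟩
    · exact ⟨o, by simp, u, hu, by simp [show u = α ++ [y] by simpa using h]⟩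
    · obtain ⟨-, hz⟩ := List.append_inj' (s₁ := u ++ v) (t₁ := [z]) (s₂ := α) (t₂ := [y])
        (by simpa using h) rfl
      obtain rfl : z = y := by simpa using hz
      obtain ⟨o', ho', h'⟩ := ih v (by simpa using hv)
      exact ⟨o', by simp [ho'], h'⟩

theorem exists_head?_of_mem_prod {X Y : Type} {μ : X → Language Y} {w : List X} {v : List Y}
    (h : v ∈ (w.map μ).prod) {y : Y} (hy : v.head? = some y) :
    ∃ o ∈ w, ∃ u ∈ μ o, u.head? = some y := by
  induction w generalizing v with
  | nil => simp [mem_prod_nil.1 h] at hy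
  | cons o w ih =>
    obtain ⟨u, hu, v, hv, rfl⟩ := mem_prod_cons.1 h
    cases u with
    | nil =>
      obtain ⟨o', ho', h'⟩ := ih hv (by simpa using hy)
      exact ⟨o', by simp [ho'], h'⟩
    | cons z u => exact ⟨o, by simp, z :: u, hu, by simpa using hy⟩

variable {F}

/-- If the last action of an image under the fusion morphism belongs to the body of a block, then
its edge leads to the exit location of the block. -/
theorem tgt_eq_exit_of_getLast? {o : Act} (ho : o ∈ F.outer.alphabet) {u : List Act}
    (hu : u ∈ F.morphism o) {B : Act × CFG Loc Act} (hB : B ∈ F.blocks) {e : Edge Loc Act}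
    (he : e ∈ B.2.edges) (hl : u.getLast? = some e.label) : e.tgt = B.2.exit := by
  obtain ⟨ρ, hρ⟩ := F.insertion
  obtain ⟨α, rfl⟩ := List.getLast?_eq_some_iff.1 hl
  by_cases hos : o ∈ F.blocks.map Prod.fst
  · obtain ⟨B', hB', rfl⟩ := List.mem_map.1 hos
    obtain ⟨ℓ, -, h⟩ := run_append_iff.1 (show Run _ _ _ _ from (F.morphism_of_mem hB').1 hu)
    obtain ⟨ℓ', h1, h2⟩ := run_cons_iff.1 h
    obtain rfl := run_nil_iff.1 h2
    obtain rfl := block_unique hρ hB' hB h1 he rfl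
    obtain h3 := CFG.edge_ext h1 he rfl
    rw [← h3]
  · have h := (F.morphism_of_notMem hos).1 hu
    obtain ⟨-, h2⟩ := List.append_inj' (s₂ := []) h rfl
    obtain ⟨g, hg, rfl⟩ := ho
    exact absurd (by simpa using h2.symm) (outer_label_ne hρ hg hos hB he)

theorem src_eq_init_of_head? {o : Act} (ho : o ∈ F.outer.alphabet) {u : List Act}
    (hu : u ∈ F.morphism o) {B : Act × CFG Loc Act} (hB : B ∈ F.blocks) {e : Edge Loc Act}
    (he : e ∈ B.2.edges) (hl : u.head? = some e.label) : e.src = B.2.init := by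
  obtain ⟨ρ, hρ⟩ := F.insertion
  obtain ⟨u, rfl⟩ := List.head?_eq_some_iff.1 hl
  by_cases hos : o ∈ F.blocks.map Prod.fst
  · obtain ⟨B', hB', rfl⟩ := List.mem_map.1 hos
    obtain ⟨ℓ', h1, h2⟩ := run_cons_iff.1 (show Run _ _ _ _ from (F.morphism_of_mem hB').1 hu)
    obtain rfl := block_unique hρ hB' hB h1 he rfl
    obtain h3 := CFG.edge_ext h1 he rfl
    rw [← h3]
  · have h := (F.morphism_of_notMem hos).1 hu
    obtain ⟨g, hg, rfl⟩ := ho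
    exact absurd (List.cons.inj h).1.symm (outer_label_ne hρ hg hos hB he)

/-- In a fused interleaving, no other thread acts between two linked actions of a thread. -/
theorem not_linked_of_mem_fused {α β : List (Act × ℕ)} {c : Act} {i j : ℕ}
    (h : α ++ (c, i) :: β ∈ F.fused) (hij : i ≠ j) {a b : Act}
    (ha : (localTrace α j).getLast? = some a) (hb : (localTrace β j).head? = some b) :
    ¬ F.Linked a b := by
  rintro ⟨B, hB, e, f, ⟨he, hf, hef⟩, rfl, rfl⟩
  obtain ⟨w, hw, h⟩ := h
  obtain ⟨w₁, ⟨o, k⟩, w₂, rfl, v₁, v', v'', v₂, rfl, rfl, h1, ⟨u, -, hu⟩, h2⟩ := mem_prod_split h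
  have hk : i = k := by
    have : (c, i) ∈ u.map fun y => (y, k) := hu ▸ by simp
    simp only [List.mem_map, Prod.mk.injEq] at this
    obtain ⟨_, _, _, h⟩ := this
    exact h.symm
  have hloc : localTrace (v' ++ (c, i) :: v'') j = [] := by
    rw [hu, localTrace_map, if_neg (hk ▸ hij)]
  rw [localTrace_append, localTrace_cons, if_neg hij, List.append_eq_nil_iff] at hloc
  rw [localTrace_append, hloc.1, List.append_nil] at ha
  rw [localTrace_append, hloc.2, List.nil_append] at hb
  obtain ⟨o₁, ho₁, u₁, hu₁, hl₁⟩ :=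
    exists_getLast?_of_mem_prod (F.localTrace_mem_prod h1 j) ha
  obtain ⟨o₂, ho₂, u₂, hu₂, hl₂⟩ :=
    exists_head?_of_mem_prod (F.localTrace_mem_prod h2 j) hb
  have halph : ∀ o' ∈ localTrace (w₁ ++ (o, k) :: w₂) j, o' ∈ F.outer.alphabet := by
    intro o' ho
    rcases hw j with h | h
    · exact Run.exists_edge h ho
    · rw [h] at ho
      simp at ho
  have h3 := tgt_eq_exit_of_getLast? (halph o₁ (by simp [ho₁])) hu₁ hB he hl₁
  have h4 := src_eq_init_of_head? (halph o₂ (by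
    rw [localTrace_append, localTrace_cons]; split_ifs <;> simp [ho₂])) hu₂ hB hf hl₂
  exact B.2.init_ne_exit (by rw [← h3, hef, h4])

theorem linked_of_run {B : Act × CFG Loc Act} (hB : B ∈ F.blocks) {ℓ ℓ' : Loc} {u : List Act}
    (h : Run B.2.edges ℓ u ℓ') {s : ℕ} {x y : Act} (hx : u[s]? = some x)
    (hy : u[s + 1]? = some y) : F.Linked x y := by
  induction s generalizing ℓ u with
  | zero =>
    rcases h with _ | ⟨he, h⟩
    · simp at hx
    · rcases h with _ | ⟨hf, h⟩
      · simp at hy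
      · simp only [List.getElem?_cons_zero, Option.some.injEq, List.getElem?_cons_succ,
          zero_add] at hx hy
        exact ⟨B, hB, _, _, ⟨he, hf, rfl⟩, hx, hy⟩
  | succ s ih =>
    rcases h with _ | ⟨he, h⟩
    · simp at hx
    · exact ih h (by simpa using hx) (by simpa using hy)

/-- A path inside a block is executed without interruption in a fused interleaving. -/
theorem contiguous_of_mem_fused {α β : List (Act × ℕ)} {x : Act} {i : ℕ} {u q : List Act}
    (h : α ++ (x, i) :: β ∈ F.fused) {B : Act × CFG Loc Act} (hB : B ∈ F.blocks) {ℓ ℓ' : Loc}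
    (hu : Run B.2.edges ℓ (x :: u) ℓ') (hβ : localTrace β i = u ++ q) :
    ∃ β', β = (u.map fun a => (a, i)) ++ β' := by
  induction u generalizing α β x ℓ with
  | nil => exact ⟨β, rfl⟩
  | cons y u ih =>
    rcases β with _ | ⟨⟨z, j⟩, β⟩
    · simp at hβ
    have hlink := linked_of_run hB hu (s := 0) rfl rfl
    have hj : j = i := by
      by_contra hj
      refine not_linked_of_mem_fused (α := α ++ [(x, i)]) (c := z) (β := β) (by simpa using h) hj
        ?_ ?_ hlink
      · simp [localTrace_cons]
      · rw [localTrace_cons, if_neg hj] at hβ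
        simp [hβ]
    subst hj
    rw [localTrace_cons, if_pos rfl] at hβ
    obtain ⟨rfl, hβ'⟩ := List.cons.inj hβ
    obtain ⟨_, _, hu'⟩ := run_cons_iff.1 hu
    obtain ⟨β', rfl⟩ := ih (α := α ++ [(x, j)]) (by simpa using h) hu' hβ'
    exact ⟨β', rfl⟩

/-! ### A witness refutes soundness -/

theorem exists_trace_embed {B : Act × CFG Loc Act} (hB : B ∈ F.blocks) {ℓ ℓ' : Loc}
    (hℓ : ℓ ∈ B.2.locs) (hℓ' : ℓ' ∈ B.2.locs) {u : List Act} (hu : Run B.2.edges ℓ u ℓ') :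
    ∃ p q, p ++ u ++ q ∈ G.traces := by
  obtain ⟨ρ, hρ⟩ := F.insertion
  exact CFG.exists_trace_of_run ((hρ.locs_iff _).2 (Or.inr ⟨B, hB, ℓ, hℓ, rfl⟩))
    ((hρ.locs_iff _).2 (Or.inr ⟨B, hB, ℓ', hℓ', rfl⟩)) (run_embed hρ hB hu)

/-- A link between two actions occurs in some trace `t` of `G`: either the first action comes before
the second one, or both belong to an uninterruptible part of the trace. -/
theorem exists_trace_of_link {a b : Act} (h : Link G F.blocks a b) :
    ∃ t ∈ G.traces, ∃ k l : ℕ, t[k]? = some a ∧ t[l]? = some b ∧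
      (k ≤ l ∨ ∀ s, l ≤ s → s < k →
        ∃ x y, t[s]? = some x ∧ t[s + 1]? = some y ∧ F.Linked x y) := by
  rcases h with ⟨ρ, ι, σ, ht, ha, hb⟩ | ⟨B, hB, ρ, ι, σ, hu⟩
  · refine ⟨_, ht, ρ.length, ρ.length + (ι.length - 1), ?_, ?_, Or.inl (by omega)⟩
    · rw [List.append_assoc, List.getElem?_append_right le_rfl]
      obtain ⟨ι, rfl⟩ := List.head?_eq_some_iff.1 ha
      simp
    · rw [List.append_assoc, List.getElem?_append_right (by omega)]
      obtain ⟨ι, rfl⟩ := List.getLast?_eq_some_iff.1 hb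
      simp
  · obtain ⟨p, q, ht⟩ := exists_trace_embed hB B.2.init_mem B.2.exit_mem hu
    refine ⟨_, ht, p.length + (ρ.length + 1 + ι.length), p.length + ρ.length, ?_, ?_,
      Or.inr fun s hls hsk => ?_⟩
    · have : p ++ (ρ ++ [b] ++ ι ++ [a] ++ σ) ++ q = (p ++ ρ ++ [b] ++ ι) ++ a :: (σ ++ q) := by
        simp
      have hlen : (p ++ ρ ++ [b] ++ ι).length = p.length + (ρ.length + 1 + ι.length) := by
        simp; omega
      rw [this, List.getElem?_append_right hlen.le, hlen, Nat.sub_self]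
      rfl
    · have : p ++ (ρ ++ [b] ++ ι ++ [a] ++ σ) ++ q = (p ++ ρ) ++ b :: (ι ++ a :: (σ ++ q)) := by
        simp
      rw [this, List.getElem?_append_right (by simp)]
      simp
    · obtain ⟨s, rfl⟩ := Nat.exists_eq_add_of_le (show p.length ≤ s by omega)
      have hlen : (ρ ++ [b] ++ ι ++ [a] ++ σ).length =
        ρ.length + 1 + ι.length + 1 + σ.length := by simp; omega
      obtain ⟨u, hu'⟩ : ∃ u, u = ρ ++ [b] ++ ι ++ [a] ++ σ := ⟨_, rfl⟩
      rw [← hu'] at hu hlen ⊢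
      have hget : ∀ r, r < u.length → (p ++ u ++ q)[p.length + r]? = u[r]? := fun r hr => by
        rw [List.append_assoc, List.getElem?_append_right (by omega), Nat.add_sub_cancel_left,
          List.getElem?_append_left hr]
      rw [add_assoc, hget _ (by omega), hget _ (by omega)]
      refine ⟨u[s]'(by omega), u[s + 1]'(by omega), by simp, by simp,
        linked_of_run hB hu (s := s) ?_ ?_⟩ <;> simp

/-- Links carry events of a thread beyond a point of a fused interleaving at which another thread
acts. -/
theorem length_le_of_linked {α β : List (Act × ℕ)} {c : Act} {i j : ℕ}
    (h : α ++ (c, i) :: β ∈ F.fused) (hij : i ≠ j) {t : List Act}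
    (ht : localTrace (α ++ (c, i) :: β) j = t) {k l : ℕ} (hkt : k < t.length)
    (hkl : k ≤ l ∨ ∀ s, l ≤ s → s < k →
      ∃ x y, t[s]? = some x ∧ t[s + 1]? = some y ∧ F.Linked x y)
    (hk : (localTrace α j).length ≤ k) : (localTrace α j).length ≤ l := by
  rcases hkl with hkl | hkl
  · omega
  by_contra hl
  obtain ⟨x, y, hx, hy, hxy⟩ := hkl ((localTrace α j).length - 1) (by omega) (by omega)
  rw [localTrace_append, localTrace_cons, if_neg hij] at ht
  subst ht
  refine not_linked_of_mem_fused h hij ?_ ?_ hxy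
  · rw [List.getElem?_append_left (by omega)] at hx
    rw [List.getLast?_eq_getElem?, hx]
  · rw [List.getElem?_append_right (by omega)] at hy
    rw [List.head?_eq_getElem?, ← hy]
    congr 1
    omega

/-- A dependence chain from `a` to `b` yields an execution `T` of threads `1, …, N`, one for each
link of the chain, with the following property. Let `T` be executed in some context, and let a fused
interleaving cover the result. If at some point of the latter at which thread `0` acts the given
occurrence of `a` has not happened yet, then the given occurrence of `b` has not happened either. -/
theorem exists_threads_of_chain {I : List (Act × Act)} {a b : Act}
    (h : Chain G F.blocks I a b) :
    ∃ (N : ℕ) (T : List (Act × ℕ)) (k l : ℕ), 1 ≤ N ∧ (∀ x ∈ T, 1 ≤ x.2 ∧ x.2 ≤ N) ∧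
      (∀ i, 1 ≤ i → i ≤ N → localTrace T i ∈ G.traces) ∧ (localTrace T 1)[k]? = some a ∧
      (localTrace T N)[l]? = some b ∧
      ∀ U V τ', (∀ x ∈ U ++ V, ¬ (1 ≤ x.2 ∧ x.2 ≤ N)) → CoveredBy I (U ++ T ++ V) τ' →
        τ' ∈ F.fused → ∀ α c β, τ' = α ++ (c, 0) :: β →
        (localTrace α 1).length ≤ k → (localTrace α N).length ≤ l := by
  have hnil : ∀ (W : List (Act × ℕ)) (i : ℕ), (∀ x ∈ W, x.2 ≠ i) → localTrace W i = [] := by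
    intro W i hW
    simp only [localTrace, List.map_eq_nil_iff, List.filter_eq_nil_iff, decide_eq_true_eq]
    exact hW
  obtain ⟨c, hac, hcb⟩ := h
  induction hcb with
  | refl =>
    obtain ⟨t, ht, k, l, hk, hl, hkl⟩ := exists_trace_of_link hac
    refine ⟨1, t.map fun x => (x, 1), k, l, le_rfl, ?_, ?_, ?_, ?_, ?_⟩
    · simp
    · intro i h1 h2
      obtain rfl : i = 1 := by omega
      simpa using ht
    · simpa using hk
    · simpa using hl
    · intro U V τ' hUV hcov hτ' α c β hα h
      subst hα
      refine length_le_of_linked hτ' (by omega) (t := t) ?_ (List.getElem?_eq_some_iff.1 hk).1 hkl h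
      rw [hcov.localTrace_eq, localTrace_append, localTrace_append,
        hnil U 1 fun x hx h => hUV x (by simp [hx]) (by omega),
        hnil V 1 fun x hx h => hUV x (by simp [hx]) (by omega)]
      simp
  | tail _ hstep ih =>
    obtain ⟨N, T, k, l, hN, hT, htr, hk, hl, hprop⟩ := ih
    obtain ⟨x, ⟨-, -, hdep⟩, hlink⟩ := hstep
    obtain ⟨t, ht, k', l', hk', hl', hkl⟩ := exists_trace_of_link hlink
    have hTN : localTrace T (N + 1) = [] := hnil T _ fun x hx h => by have := hT x hx; omega
    refine ⟨N + 1, T ++ t.map fun x => (x, N + 1), k, l', by omega, ?_, ?_, ?_, ?_, ?_⟩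
    · intro x hx
      rcases List.mem_append.1 hx with hx | hx
      · have := hT x hx; omega
      · obtain ⟨_, _, rfl⟩ := List.mem_map.1 hx
        exact ⟨by simp, le_rfl⟩
    · intro i h1 h2
      rw [localTrace_append, localTrace_map]
      by_cases hi : N + 1 = i
      · subst hi
        simpa [hTN] using ht
      · rw [if_neg hi, List.append_nil]
        exact htr i h1 (by omega)
    · rw [localTrace_append, localTrace_map, if_neg (by omega), List.append_nil, hk]
    · rw [localTrace_append, localTrace_map, if_pos rfl, hTN, List.nil_append, hl']
    · intro U V τ' hUV hcov hτ' α c β hα h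
      subst hα
      have h1 := hprop U ((t.map fun x => (x, N + 1)) ++ V) _ (by
        intro x hx
        simp only [List.mem_append, List.mem_map] at hx
        rcases hx with hx | ⟨_, _, rfl⟩ | hx
        · have := hUV x (by simp [hx]); omega
        · simp
        · have := hUV x (by simp [hx]); omega) (by simpa using hcov) hτ' α c β rfl h
      have hU : ∀ i, 1 ≤ i → i ≤ N + 1 → localTrace U i = [] := fun i h1 h2 =>
        hnil U i fun x hx h => hUV x (by simp [hx]) (by omega)
      have hV : ∀ i, 1 ≤ i → i ≤ N + 1 → localTrace V i = [] := fun i h1 h2 =>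
        hnil V i fun x hx h => hUV x (by simp [hx]) (by omega)
      have hbef : Before ((U ++ T) ++ ((t.map fun x => (x, N + 1)) ++ V)) N l (N + 1) k' := by
        refine before_append ?_ ?_
        · rw [localTrace_append, hU N hN (by omega), List.nil_append]
          exact (List.getElem?_eq_some_iff.1 hl).1
        · rw [localTrace_append, hU _ (by omega) le_rfl, hTN]
          simp
      have hcov' : CoveredBy I ((U ++ T) ++ ((t.map fun x => (x, N + 1)) ++ V))
        (α ++ (c, 0) :: β) := by simpa using hcov
      have hbef' := hbef.coveredBy (by omega) (a := _) (b := x) (by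
          rw [localTrace_append, localTrace_append, localTrace_append, localTrace_map,
            hU N hN (by omega), hV N hN (by omega), if_neg (by omega)]
          simpa using hl) (by
          rw [localTrace_append, localTrace_append, localTrace_append, localTrace_map,
            hU _ (by omega) le_rfl, hV _ (by omega) le_rfl, if_pos rfl, hTN]
          simpa using hk') hdep hcov'
      have h2 : (localTrace α (N + 1)).length ≤ k' := by
        by_contra h2
        have := hbef' α _ rfl (by omega)
        omega
      refine length_le_of_linked hτ' (by omega) (t := t) ?_ (List.getElem?_eq_some_iff.1 hk').1
        hkl h2
      rw [hcov.localTrace_eq, localTrace_append, localTrace_append, localTrace_append,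
        localTrace_map, hU _ (by omega) le_rfl, hV _ (by omega) le_rfl, if_pos rfl, hTN]
      simp

/-- Thread `0` executes a block up to `e`, the threads of a dependence chain run one after the
other, and thread `0` goes on to `f` in the same block. In a fused interleaving that covers this,
the chain would have to start after `e` and to end before `f`, but nothing can happen between
`e` and `f`. -/
theorem not_sound_of_hasWitness {I : List (Act × Act)} (h : HasWitness G F.blocks I) :
    ¬ F.Sound I := by
  obtain ⟨B, hB, e, f, hef, a, b, hab, hea, hbf⟩ := (hasWitness_iff F.blocks_alphabet_subset).1 h
  obtain ⟨N, T, k, l, hN, hT, htr, hk, hl, hprop⟩ := exists_threads_of_chain hab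
  obtain ⟨ι, hι⟩ := exists_run_of_transGen hef
  have he : e ∈ B.2.edges := by
    obtain ⟨_, h, -⟩ := Relation.TransGen.head'_iff.1 hef
    exact h.1
  have hf : f ∈ B.2.edges := by
    obtain ⟨_, -, h⟩ := Relation.TransGen.tail'_iff.1 hef
    exact h.2.1
  obtain ⟨p, q, hpq⟩ := exists_trace_embed hB (B.2.src_mem _ he) (B.2.tgt_mem _ hf) hι
  rintro ⟨-, hsound⟩
  set U : List (Act × ℕ) := (p ++ [e.label]).map fun x => (x, 0) with hU
  set V : List (Act × ℕ) := (ι ++ [f.label] ++ q).map fun x => (x, 0) with hV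
  have hT0 : localTrace T 0 = [] := by
    simp only [localTrace, List.map_eq_nil_iff, List.filter_eq_nil_iff, decide_eq_true_eq]
    intro x hx h
    have := hT x hx
    omega
  have hτ0 : localTrace (U ++ T ++ V) 0 = p ++ e.label :: (ι ++ [f.label] ++ q) := by
    simp [hU, hV, hT0, localTrace_append, localTrace_cons]
  have hτi : ∀ i, 1 ≤ i → localTrace (U ++ T ++ V) i = localTrace T i := by
    intro i hi
    simp only [localTrace_append, hU, hV, localTrace_map, if_neg (show (0 : ℕ) ≠ i by omega),
      List.nil_append, List.append_nil]
  obtain ⟨τ', hτ', hcov⟩ := hsound (U ++ T ++ V) (by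
    intro i
    rcases Nat.eq_zero_or_pos i with rfl | hi
    · left
      rw [hτ0]
      simpa using hpq
    · rw [hτi i hi]
      by_cases hiN : i ≤ N
      · exact Or.inl (htr i hi hiN)
      · right
        simp only [localTrace, List.map_eq_nil_iff, List.filter_eq_nil_iff, decide_eq_true_eq]
        intro x hx h
        have := hT x hx
        omega)
  obtain ⟨α, β, rfl, hα, hβ⟩ := exists_cut ((hcov.localTrace_eq 0).trans hτ0)
  have hUT0 : localTrace (U ++ T) 0 = p ++ [e.label] := by
    rw [localTrace_append, hT0, hU, localTrace_map, if_pos rfl, List.append_nil]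
  have hUTi : ∀ i, 1 ≤ i → localTrace (U ++ T) i = localTrace T i := by
    intro i hi
    rw [localTrace_append, hU, localTrace_map, if_neg (by omega), List.nil_append]
  -- The chain starts after `e`.
  have hstart : (localTrace α 1).length ≤ k := by
    have hbef : Before (U ++ (T ++ V)) 0 p.length 1 k := by
      refine before_append ?_ ?_ <;> simp [hU, localTrace_cons]
    have := hbef.coveredBy (by omega) (a := e.label) (b := a)
      (by rw [← List.append_assoc, hτ0]; simp)
      (by rw [← List.append_assoc, hτi 1 le_rfl, hk]) hea (by simpa using hcov) α _ rfl
    rw [hα] at this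
    omega
  have hend := hprop U V _ (by
    intro x hx
    rw [hU, hV, ← List.map_append] at hx
    obtain ⟨_, _, rfl⟩ := List.mem_map.1 hx
    simp) hcov hτ' α e.label β rfl hstart
  -- Nothing happens between `e` and `f`, and the chain ends before `f`.
  obtain ⟨β', rfl⟩ := contiguous_of_mem_fused (u := ι ++ [f.label]) (q := q) hτ' hB
    (by simpa using hι) hβ
  have hbef : Before (U ++ T ++ V) N l 0 (p.length + 1 + ι.length) := by
    refine before_append ?_ ?_
    · rw [hUTi N hN]
      exact (List.getElem?_eq_some_iff.1 hl).1
    · rw [hUT0]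
      simp
  have hlt := hbef.coveredBy (by omega) (a := b) (b := f.label) (by rw [hτi N hN, hl]) (by
      rw [hτ0]
      have : p ++ e.label :: (ι ++ [f.label] ++ q) = (p ++ [e.label] ++ ι) ++ f.label :: q := by
        simp
      have hlen : (p ++ [e.label] ++ ι).length = p.length + 1 + ι.length := by simp; omega
      rw [this, List.getElem?_append_right hlen.le, hlen, Nat.sub_self]
      rfl) hbf hcov
    (α ++ (e.label, 0) :: (ι ++ [f.label]).map fun x => (x, 0)) β' (by simp) (by
      rw [localTrace_append, localTrace_cons, if_pos rfl, localTrace_map, if_pos rfl, hα]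
      simp
      omega)
  rw [localTrace_append, localTrace_cons, if_neg (by omega), localTrace_map, if_neg (by omega),
    List.append_nil] at hlt
  omega

end AtomicFusion

/-! ### Serialization of chunks -/

section Serialization

variable {Act : Type} {I : List (Act × Act)}

theorem CoveredBy.append_left {τ τ' : List (Act × ℕ)} (h : CoveredBy I τ τ')
    (α : List (Act × ℕ)) : CoveredBy I (α ++ τ) (α ++ τ') := by
  induction h with
  | refl => exact .refl
  | tail _ h ih =>
    obtain ⟨ρ, σ, a, b, i, j, hab, hij, rfl, rfl⟩ := h
    exact ih.tail ⟨α ++ ρ, σ, a, b, i, j, hab, hij, by simp, by simp⟩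

theorem coveredBy_move {x : Act × ℕ} {φ : List (Act × ℕ)}
    (h : ∀ y ∈ φ, x.2 ≠ y.2 ∧ (x.1, y.1) ∈ I) (σ : List (Act × ℕ)) :
    CoveredBy I (x :: φ ++ σ) (φ ++ x :: σ) := by
  induction φ with
  | nil => exact .refl
  | cons y φ ih =>
    have hy := h y (by simp)
    refine .head (b := y :: (x :: φ ++ σ)) ?_
      ((ih fun z hz => h z (by simp [hz])).append_left [y])
    exact ⟨[], φ ++ σ, x.1, y.1, x.2, y.2, hy.2, hy.1, by simp, by simp⟩

/-- The events that satisfy `P` can be moved to the front if they may be swapped with all earlier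
events that do not satisfy `P`. -/
theorem coveredBy_partition {E : Type} {f : E → Act × ℕ} {P : E → Bool} {l : List E}
    (h : l.Pairwise fun x y => P x = false → P y = true →
      (f x).2 ≠ (f y).2 ∧ ((f x).1, (f y).1) ∈ I) :
    CoveredBy I (l.map f) ((l.filter P ++ l.filter fun x => !P x).map f) := by
  induction l with
  | nil => exact .refl
  | cons x l ih =>
    obtain ⟨hx, hl⟩ := List.pairwise_cons.1 h
    have ih' := (ih hl).append_left [f x]
    cases hP : P x with
    | true => simpa [hP] using ih'
    | false =>
      refine Relation.ReflTransGen.trans ih' ?_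
      have := coveredBy_move (I := I) (x := f x) (φ := (l.filter P).map f) (by
        intro y hy
        obtain ⟨z, hz, rfl⟩ := List.mem_map.1 hy
        exact hx z (List.mem_of_mem_filter hz) hP (List.mem_filter.1 hz).2)
        ((l.filter fun x => !P x).map f)
      simpa [hP, CoveredBy] using this

variable {n : ℕ} (I) (f : Fin n → Act × ℕ) (blk : Fin n → ℕ)

/-- The chunk of the event at position `p`: its thread, and the number of the chunk within the
thread. -/
def chunk (p : Fin n) : ℕ × ℕ := ((f p).2, blk p)

/-- The event at `p` precedes the event at `q` of another thread, and swaps must not change this. -/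
def Delay (p q : Fin n) : Prop := p < q ∧ (f p).2 ≠ (f q).2 ∧ ((f p).1, (f q).1) ∉ I

/-- The events at `p` and `q` belong to the same thread, and `p` comes before `q` or is executed
atomically with `q`. -/
def InThread (p q : Fin n) : Prop := (f p).2 = (f q).2 ∧ (p ≤ q ∨ blk p = blk q)

/-- One round of a dependence cycle: a move within a thread, and a delay of another thread. -/
def Round (p q : Fin n) : Prop := ∃ p', InThread f blk p p' ∧ Delay I f p' q

variable {I f blk}

/-- Unless rounds go on for ever, some chunk of `l` need not wait for any other chunk. -/
theorem exists_free_chunk (hmono : ∀ p q, p ≤ q → (f p).2 = (f q).2 → blk p ≤ blk q)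
    (hwf : WellFounded (Round I f blk)) {l : List (Fin n)} (hl : l ≠ []) :
    ∃ y ∈ l, ∀ x ∈ l, ∀ y' ∈ l, chunk f blk y' = chunk f blk y → chunk f blk x ≠ chunk f blk y →
      x < y' → (f x).2 ≠ (f y').2 ∧ ((f x).1, (f y').1) ∈ I := by
  by_contra! hno
  -- The first chunk of a thread can only be delayed by an event of another thread.
  have hfirst : ∀ p ∈ l, ∃ x ∈ l, ∃ y ∈ l, InThread f blk y p ∧ Delay I f x y := by
    intro p hp
    obtain ⟨y, ⟨hy, hyp⟩, hmin⟩ := (InvImage.wf blk wellFounded_lt).has_min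
      {q | q ∈ l ∧ (f q).2 = (f p).2} ⟨p, hp, rfl⟩
    obtain ⟨x, hx, y', hy', hc, hne, hlt, hI⟩ := hno y hy
    simp only [chunk, Prod.mk.injEq, ne_eq, not_and] at hc hne
    have hmin' : ∀ q ∈ l, (f q).2 = (f p).2 → blk y ≤ blk q := fun q hq h =>
      not_lt.1 (hmin q ⟨hq, h⟩)
    have hthr : (f x).2 ≠ (f y').2 := by
      intro h
      refine hne (h.trans hc.1) (le_antisymm ?_ (hmin' x hx (h.trans (hc.1.trans hyp))))
      exact hc.2 ▸ hmono x y' hlt.le h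
    refine ⟨x, hx, y', hy', ⟨hc.1.trans hyp, ?_⟩, hlt, hthr, hI hthr⟩
    by_contra! h
    have h1 := hmono p y' h.1.le (hc.1.trans hyp).symm
    have h2 := hmin' p hp rfl
    exact h.2 (by omega)
  have key : ∀ q : Fin n, ∀ p ∈ l, Delay I f p q → False := by
    intro q
    induction q using hwf.induction with
    | _ q ih =>
      intro p hp hpq
      obtain ⟨x, hx, y, hy, hyp, hxy⟩ := hfirst p hp
      exact ih y ⟨p, hyp, hpq⟩ x hx hxy
  obtain ⟨p, hp⟩ := List.exists_mem_of_ne_nil l hl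
  obtain ⟨x, hx, y, -, -, hxy⟩ := hfirst p hp
  exact key y x hx hxy

/-- If rounds do not go on for ever, then the chunks can be executed one after the other, where the
chunks of each thread keep their order. -/
theorem exists_serialization (hmono : ∀ p q, p ≤ q → (f p).2 = (f q).2 → blk p ≤ blk q)
    (hwf : WellFounded (Round I f blk)) (l : List (Fin n)) (hl : l.Pairwise (· < ·)) :
    ∃ cs : List (ℕ × ℕ),
      CoveredBy I (l.map f)
        ((cs.flatMap fun c => l.filter fun p => chunk f blk p = c).map f) ∧
      (∀ c, c ∈ cs ↔ ∃ p ∈ l, chunk f blk p = c) ∧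
      cs.Pairwise fun c c' => c.1 = c'.1 → c.2 < c'.2 := by
  induction hlen : l.length using Nat.strong_induction_on generalizing l with
  | _ m ih =>
    rcases eq_or_ne l [] with rfl | hne
    · exact ⟨[], .refl, by simp, .nil⟩
    obtain ⟨y, hy, hfree⟩ := exists_free_chunk hmono hwf hne
    set c := chunk f blk y with hc
    have hlt : (l.filter fun p => !decide (chunk f blk p = c)).length < m := by
      rw [← hlen]
      exact List.length_filter_lt_length_iff_exists.2 ⟨y, hy, by simp [hc]⟩
    obtain ⟨cs, h1, h2, h3⟩ := ih _ hlt (l.filter fun p => !decide (chunk f blk p = c))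
      (hl.filter _) rfl
    have hcs : ∀ c' ∈ cs, c' ≠ c ∧ ∃ p ∈ l, chunk f blk p = c' := by
      intro c' hc'
      obtain ⟨p, hp, rfl⟩ := (h2 c').1 hc'
      simp only [List.mem_filter, Bool.not_eq_true', decide_eq_false_iff_not] at hp
      exact ⟨hp.2, p, hp.1, rfl⟩
    refine ⟨c :: cs, ?_, ?_, List.pairwise_cons.2 ⟨?_, h3⟩⟩
    · have hpart := coveredBy_partition (I := I) (f := f)
        (P := fun p => decide (chunk f blk p = c)) (l := l) (hl.imp_of_mem fun hx hy' hxy hPx hPy =>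
          hfree _ hx _ hy' (by simpa using hPy) (by simpa using hPx) hxy)
      refine hpart.trans ?_
      have hfil : (cs.flatMap fun c' => (l.filter fun p => !decide (chunk f blk p = c)).filter
          fun p => decide (chunk f blk p = c')) =
            cs.flatMap fun c' => l.filter fun p => decide (chunk f blk p = c') := by
        refine List.flatMap_congr fun c' hc' => ?_
        rw [List.filter_filter]
        refine List.filter_congr fun p _ => ?_
        by_cases h : chunk f blk p = c'
        · simp [h, (hcs c' hc').1]
        · simp [h]
      rw [hfil] at h1
      rw [List.flatMap_cons, List.map_append, List.map_append]
      exact h1.append_left _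
    · intro c'
      rw [List.mem_cons]
      constructor
      · rintro (rfl | h)
        · exact ⟨y, hy, hc.symm⟩
        · exact (hcs c' h).2
      · rintro ⟨p, hp, rfl⟩
        by_cases h : chunk f blk p = c
        · exact Or.inl h
        · exact Or.inr ((h2 _).2 ⟨p, by simp [hp, h], rfl⟩)
    · intro c' hc' hthr
      obtain ⟨hne', x, hx, rfl⟩ := hcs c' hc'
      by_contra hle
      have hblk : blk x < blk y := by
        have h4 : blk x ≠ blk y := fun h => hne' (Prod.ext hthr.symm h)
        have h5 : ¬ blk y < blk x := hle
        omega
      have hxy : x < y := by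
        by_contra h
        have := hmono y x (not_lt.1 h) hthr
        omega
      exact (hfree x hx y hy rfl hne' hxy).1 hthr.symm

/-! ### Rounds without a witness -/

/-- If rounds go on for ever, then some round goes back in time, by a move within a chunk, and is
part of a cycle of rounds. -/
theorem exists_back_round (h : ¬ WellFounded (Round I f blk)) :
    ∃ p q r, (f p).2 = (f q).2 ∧ blk p = blk q ∧ p < q ∧ Delay I f p r ∧
      Relation.TransGen (Round I f blk) r q := by
  have hcyc : ∃ p, Relation.TransGen (Round I f blk) p p := by
    by_contra! hirr
    have : Std.Irrefl (Relation.TransGen (Round I f blk)) := ⟨hirr⟩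
    have hwf := Finite.wellFounded_of_trans_of_irrefl (Relation.TransGen (Round I f blk))
    exact h (Subrelation.wf (fun h => Relation.TransGen.single h) hwf)
  obtain ⟨p, hp⟩ := hcyc
  have key : ∀ q, Relation.TransGen (Round I f blk) p q → p < q ∨
      ∃ u v, Relation.ReflTransGen (Round I f blk) p u ∧ Round I f blk u v ∧ ¬ u < v ∧
        Relation.ReflTransGen (Round I f blk) v q := by
    intro q hq
    induction hq with
    | @single v h =>
      by_cases hlt : p < v
      · exact Or.inl hlt
      · exact Or.inr ⟨p, v, .refl, h, hlt, .refl⟩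
    | @tail u v h h' ih =>
      rcases ih with hpu | ⟨u', v', h1, h2, h3, h4⟩
      · by_cases hlt : u < v
        · exact Or.inl (hpu.trans hlt)
        · exact Or.inr ⟨u, v, h.to_reflTransGen, h', hlt, .refl⟩
      · exact Or.inr ⟨u', v', h1, h2, h3, h4.tail h'⟩
  obtain ⟨u, v, h1, ⟨u', ⟨hthr, hle⟩, hdel⟩, hlt, h2⟩ := (key p hp).resolve_left (lt_irrefl p)
  have hu : u' < u := by
    by_contra h
    exact hlt ((not_lt.1 h).trans_lt hdel.1)
  refine ⟨u', u, v, hthr.symm, (hle.resolve_left hu.not_ge).symm, hu, hdel, ?_⟩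
  rcases Relation.reflTransGen_iff_eq_or_transGen.1 (h2.trans h1) with rfl | h
  · exact absurd hthr.symm hdel.2.1
  · exact h

/-- A sequence of rounds spells a dependence chain. -/
theorem exists_chain_of_rounds {Loc : Type} {G : CFG Loc Act} {blocks : List (Act × CFG Loc Act)}
    (hmem : ∀ p, (f p).1 ∈ G.alphabet)
    (hlink : ∀ p q, InThread f blk p q → Link G blocks (f p).1 (f q).1) {p q : Fin n}
    (h : Relation.TransGen (Round I f blk) p q) :
    ∃ r, Chain G blocks I (f p).1 (f r).1 ∧ Delay I f r q := by
  induction h with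
  | single h =>
    obtain ⟨r, h1, h2⟩ := h
    exact ⟨r, ⟨_, hlink _ _ h1, .refl⟩, h2⟩
  | tail _ h ih =>
    obtain ⟨r, ⟨a, h1, h2⟩, h3⟩ := ih
    obtain ⟨r', h4, h5⟩ := h
    exact ⟨r', ⟨a, h1, h2.tail ⟨_, ⟨hmem _, hmem _, h3.2.2⟩, hlink _ _ h4⟩⟩, h5⟩

end Serialization

/-! ### Numbering the chunks of an interleaving -/

section Numbering

variable {Act : Type}

/-- The letters of a sequence of chunks, each with the number of its chunk; the numbers start with
`m`. -/
def numbered : ℕ → List (Act × List Act) → List (Act × ℕ)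
  | _, [] => []
  | m, p :: ps => (p.2.map fun a => (a, m)) ++ numbered (m + 1) ps

theorem numbered_map_fst (m : ℕ) (ps : List (Act × List Act)) :
    (numbered m ps).map Prod.fst = ps.flatMap Prod.snd := by
  induction ps generalizing m with
  | nil => rfl
  | cons p ps ih => simp [numbered, ih, Function.comp_def]

theorem le_of_mem_numbered {m : ℕ} {ps : List (Act × List Act)} {x : Act × ℕ}
    (h : x ∈ numbered m ps) : m ≤ x.2 ∧ x.2 < m + ps.length := by
  induction ps generalizing m with
  | nil => simp [numbered] at h
  | cons p ps ih =>
    rcases List.mem_append.1 h with h | h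
    · obtain ⟨a, -, rfl⟩ := List.mem_map.1 h
      simp
    · have := ih h
      simp only [List.length_cons]
      omega

theorem numbered_pairwise (m : ℕ) (ps : List (Act × List Act)) :
    (numbered m ps).Pairwise fun x y => x.2 ≤ y.2 := by
  induction ps generalizing m with
  | nil => exact .nil
  | cons p ps ih =>
    refine List.pairwise_append.2 ⟨?_, ih _, ?_⟩
    · rw [List.pairwise_map]
      exact List.pairwise_of_forall fun _ _ => le_rfl
    · intro x hx y hy
      obtain ⟨a, -, rfl⟩ := List.mem_map.1 hx
      have := (le_of_mem_numbered hy).1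
      simp only
      omega

theorem numbered_filter {m k : ℕ} {ps : List (Act × List Act)} {p : Act × List Act}
    (h : ps[k]? = some p) :
    ((numbered m ps).filter fun x => x.2 = m + k).map Prod.fst = p.2 := by
  induction ps generalizing m k with
  | nil => simp at h
  | cons q ps ih =>
    rw [numbered, List.filter_append, List.map_append]
    cases k with
    | zero =>
      obtain rfl : q = p := by simpa using h
      have h2 : (numbered (m + 1) ps).filter (fun x => x.2 = m + 0) = [] := by
        rw [List.filter_eq_nil_iff]
        intro x hx
        have := (le_of_mem_numbered hx).1
        simp only [decide_eq_true_eq]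
        omega
      rw [h2]
      simp [List.filter_map, Function.comp_def]
    | succ k =>
      have h1 : (q.2.map fun a => (a, m)).filter (fun x => x.2 = m + (k + 1)) = [] := by
        rw [List.filter_eq_nil_iff]
        intro x hx
        obtain ⟨a, -, rfl⟩ := List.mem_map.1 hx
        simp
      have h2 := ih (m := m + 1) (k := k) (by simpa using h)
      rw [h1, List.map_nil, List.nil_append, ← h2, show m + (k + 1) = m + 1 + k by omega]

/-- Annotations of the local traces of a word can be merged into an annotation of the word. -/
theorem exists_annotation {X : Type} (τ : List (Act × ℕ)) (A : ℕ → List (Act × X))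
    (hA : ∀ i, (A i).map Prod.fst = localTrace τ i) :
    ∃ θ : List (Act × ℕ × X), θ.map (fun x => (x.1, x.2.1)) = τ ∧
      ∀ i, (θ.filter fun x => x.2.1 = i).map (fun x => (x.1, x.2.2)) = A i := by
  induction τ generalizing A with
  | nil => exact ⟨[], rfl, fun i => (List.map_eq_nil_iff.1 (hA i)).symm⟩
  | cons x τ ih =>
    obtain ⟨a, j⟩ := x
    have hj := hA j
    rw [localTrace_cons, if_pos rfl] at hj
    obtain ⟨⟨a', k⟩, r, hr, ha, hr'⟩ := List.map_eq_cons_iff.1 hj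
    obtain rfl : a' = a := ha
    obtain ⟨θ, h1, h2⟩ := ih (Function.update A j r) (by
      intro i
      by_cases hi : i = j
      · subst hi
        simpa using hr'
      · rw [Function.update_of_ne hi, hA i, localTrace_cons, if_neg (Ne.symm hi)])
    refine ⟨(a', j, k) :: θ, by simp [h1], fun i => ?_⟩
    have h3 := h2 i
    by_cases hi : i = j
    · subst hi
      simp [h3, hr]
    · rw [Function.update_of_ne hi] at h3
      simp [Ne.symm hi, h3]

theorem pair_sublist_of_lt {E : Type} (l : List E) {p q : Fin l.length} (h : p < q) :
    [l.get p, l.get q].Sublist l := by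
  have h1 : l.get p ∈ l.take q := by
    rw [List.mem_iff_getElem]
    have hp : (p : ℕ) < (l.take q).length := by
      rw [List.length_take]
      exact lt_min h p.2
    exact ⟨p, hp, by simp⟩
  have h2 : l.get q ∈ l.drop q := by
    rw [List.drop_eq_getElem_cons q.2]
    exact List.mem_cons_self
  have h3 := (List.singleton_sublist.2 h1).append (List.singleton_sublist.2 h2)
  rwa [List.take_append_drop] at h3

theorem filter_filter_map (θ : List (Act × ℕ × ℕ)) (i k : ℕ) :
    (θ.filter fun x => x.2 = (i, k)).map (fun x => (x.1, x.2.1)) =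
      ((((θ.filter fun x => x.2.1 = i).map fun x => (x.1, x.2.2)).filter
        fun x => x.2 = k).map Prod.fst).map fun a => (a, i) := by
  induction θ with
  | nil => rfl
  | cons x θ ih =>
    obtain ⟨a, j, m⟩ := x
    by_cases hj : j = i <;> by_cases hm : m = k <;> simp_all

/-- A list of chunk numbers that is strictly increasing within each thread lists the chunks of the
thread `i` in their order. -/
theorem localTrace_filterMap {Ps : ℕ → List (Act × List Act)} {cs : List (ℕ × ℕ)}
    (hcs : ∀ c, c ∈ cs ↔ c.2 < (Ps c.1).length)
    (hlt : cs.Pairwise fun c c' => c.1 = c'.1 → c.2 < c'.2) (i : ℕ) :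
    localTrace (cs.filterMap fun c => ((Ps c.1)[c.2]?).map fun p => (p.1, c.1)) i =
      (Ps i).map Prod.fst := by
  have h1 : ∀ cs : List (ℕ × ℕ),
      localTrace (cs.filterMap fun c => ((Ps c.1)[c.2]?).map fun p => (p.1, c.1)) i =
        ((cs.filter fun c => c.1 = i).map Prod.snd).filterMap
          fun k => ((Ps i)[k]?).map Prod.fst := by
    intro cs
    induction cs with
    | nil => rfl
    | cons c cs ih =>
      obtain ⟨j, k⟩ := c
      by_cases hj : j = i
      · subst hj
        cases hk : (Ps j)[k]? <;> simp [hk, ih, localTrace_cons]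
      · cases hk : (Ps j)[k]? <;> simp [hk, ih, localTrace_cons, hj]
  have h2 : (cs.filter fun c => c.1 = i).map Prod.snd = List.range (Ps i).length := by
    refine List.Pairwise.eq_of_mem_iff (r := (· < ·)) ?_ List.pairwise_lt_range ?_
    · rw [List.pairwise_map]
      refine (hlt.filter _).imp_of_mem fun hx hy h => h ?_
      have hx' := (List.mem_filter.1 hx).2
      have hy' := (List.mem_filter.1 hy).2
      simp only [decide_eq_true_eq] at hx' hy'
      rw [hx', hy']
    · intro k
      simp only [List.mem_map, List.mem_filter, decide_eq_true_eq, List.mem_range]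
      constructor
      · rintro ⟨⟨j, k⟩, ⟨h, rfl⟩, rfl⟩
        exact (hcs _).1 h
      · exact fun h => ⟨(i, k), ⟨(hcs _).2 h, rfl⟩, rfl⟩
  have h3 : ∀ l : List (Act × List Act),
      (List.range l.length).filterMap (fun k => (l[k]?).map Prod.fst) = l.map Prod.fst := by
    intro l
    induction l using List.reverseRecOn with
    | nil => rfl
    | append_singleton l p ih =>
      rw [List.length_append, List.length_singleton, List.range_succ, List.filterMap_append,
        List.map_append, ← ih]
      congr 1
      · refine List.filterMap_congr fun k hk => ?_
        rw [List.getElem?_append_left (List.mem_range.1 hk)]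
      · simp
  rw [h1, h2, h3]

end Numbering

/-! ### Soundness without a witness -/

namespace AtomicFusion

open Relation

variable {Loc Act : Type} {G : CFG Loc Act} {F : AtomicFusion G} {I : List (Act × Act)}

/-- Two actions in the image of one letter under the fusion morphism come from a path inside a
block, since non-block actions are not replaced. -/
theorem exists_transGen_of_mem_morphism {o a b : Act} {u : List Act} (hu : u ∈ F.morphism o)
    (hab : [a, b].Sublist u) : ∃ B ∈ F.blocks, ∃ e ∈ B.2.edges, ∃ f ∈ B.2.edges,
      e.label = a ∧ f.label = b ∧ TransGen (EdgeStep B.2.edges) e f := by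
  rcases hu with ⟨B, hB, -, hu⟩ | ⟨-, rfl⟩
  · exact ⟨B, hB, Run.exists_transGen_of_sublist hu hab⟩
  · have := hab.length_le
    simp at this

theorem mem_prod_of_chunks {cs : List (ℕ × ℕ)} {Ps : ℕ → List (Act × List Act)}
    {v : ℕ × ℕ → List (Act × ℕ)}
    (h : ∀ c ∈ cs, ∃ p, (Ps c.1)[c.2]? = some p ∧ p.2 ∈ F.morphism p.1 ∧
      v c = p.2.map fun a => (a, c.1)) :
    cs.flatMap v ∈ ((cs.filterMap fun c => ((Ps c.1)[c.2]?).map fun p => (p.1, c.1)).map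
      (liftIdx F.morphism)).prod := by
  induction cs with
  | nil => exact mem_prod_nil.2 rfl
  | cons c cs ih =>
    obtain ⟨p, hp, hμ, hv⟩ := h c (by simp)
    rw [List.filterMap_cons_some (b := (p.1, c.1)) (by simp [hp])]
    exact mem_prod_cons.2 ⟨v c, ⟨p.2, hμ, hv⟩, _, ih fun c' hc' => h c' (by simp [hc']), rfl⟩

/-- If there is no witness, then no cycle of delays runs through the chunks of an interleaving, so
that the chunks can be executed one after the other. -/
theorem sound_of_not_hasWitness (h : ¬ HasWitness G F.blocks I) : F.Sound I := by
  refine ⟨fun τ hτ => F.fused_subset hτ, fun τ hτ => ?_⟩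
  have hparse : ∀ i, ∃ ps : List (Act × List Act), (∀ p ∈ ps, p.2 ∈ F.morphism p.1) ∧
      ps.flatMap Prod.snd = localTrace τ i ∧ (ps.map Prod.fst ∈ F.outer.traces ∨ ps = []) := by
    intro i
    rcases hτ i with hi | hi
    · obtain ⟨ps, h1, h2, h3⟩ := F.exists_parse hi
      exact ⟨ps, h1, h2, Or.inl h3⟩
    · exact ⟨[], by simp, hi.symm, Or.inr rfl⟩
  choose Ps hμ hPs houter using hparse
  obtain ⟨θ, hθ, hA⟩ := exists_annotation τ (fun i => numbered 0 (Ps i)) fun i => by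
    rw [numbered_map_fst, hPs]
  let f : Fin θ.length → Act × ℕ := fun p => ((θ.get p).1, (θ.get p).2.1)
  let blk : Fin θ.length → ℕ := fun p => (θ.get p).2.2
  have hf : (List.finRange θ.length).map f = τ := by
    rw [← hθ]
    conv_rhs => rw [← List.map_get_finRange θ]
    rw [List.map_map]
    rfl
  -- The events of one thread, and the events of one chunk.
  have hmem : ∀ p, ((f p).1, blk p) ∈ numbered 0 (Ps (f p).2) := fun p => by
    rw [← hA]
    exact List.mem_map.2 ⟨θ.get p, List.mem_filter.2 ⟨List.get_mem _ _, by simp [f]⟩, rfl⟩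
  have hpair : ∀ p q, p < q → (f p).2 = (f q).2 →
      [((f p).1, blk p), ((f q).1, blk q)].Sublist (numbered 0 (Ps (f q).2)) := by
    intro p q hpq hthr
    rw [← hA]
    have h1 := ((pair_sublist_of_lt θ hpq).filter fun x => decide (x.2.1 = (f q).2)).map
      fun x => (x.1, x.2.2)
    have h2 : [θ.get p, θ.get q].filter (fun x => decide (x.2.1 = (f q).2)) =
        [θ.get p, θ.get q] := by
      rw [List.filter_eq_self]
      intro x hx
      simp only [List.mem_cons, List.not_mem_nil, or_false] at hx
      rcases hx with rfl | rfl
      · exact decide_eq_true hthr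
      · exact decide_eq_true rfl
    rwa [h2] at h1
  have hchunk : ∀ i k c, (Ps i)[k]? = some c →
      ((List.finRange θ.length).filter fun p => chunk f blk p = (i, k)).map f =
        c.2.map fun a => (a, i) := by
    intro i k c hc
    have h1 := filter_filter_map θ i k
    rw [hA, ← zero_add k, numbered_filter hc, zero_add] at h1
    rw [← h1]
    conv_rhs => rw [← List.map_get_finRange θ]
    rw [List.filter_map, List.map_map]
    rfl
  have hword : ∀ p, (f p).1 ∈ localTrace τ (f p).2 := fun p => by
    rw [← hPs, ← numbered_map_fst 0]
    exact List.mem_map.2 ⟨_, hmem p, rfl⟩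
  have htrace : ∀ p, localTrace τ (f p).2 ∈ G.traces := fun p =>
    (hτ _).resolve_right (List.ne_nil_of_mem (hword p))
  have hmono : ∀ p q, p ≤ q → (f p).2 = (f q).2 → blk p ≤ blk q := by
    intro p q hpq hthr
    rcases hpq.eq_or_lt with rfl | hpq
    · exact le_rfl
    · have := (numbered_pairwise 0 _).sublist (hpair p q hpq hthr)
      simpa using this
  have hsame : ∀ p q, p < q → (f p).2 = (f q).2 → blk p = blk q →
      ∃ B ∈ F.blocks, ∃ e ∈ B.2.edges, ∃ e' ∈ B.2.edges,
        e.label = (f p).1 ∧ e'.label = (f q).1 ∧ TransGen (EdgeStep B.2.edges) e e' := by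
    intro p q hpq hthr hblk
    have hlt := (le_of_mem_numbered (hmem q)).2
    rw [zero_add] at hlt
    have hsub := ((hpair p q hpq hthr).filter fun x => decide (x.2 = 0 + blk q)).map Prod.fst
    rw [numbered_filter (List.getElem?_eq_getElem hlt)] at hsub
    exact exists_transGen_of_mem_morphism (hμ _ _ (List.getElem_mem hlt))
      (by simpa [hblk] using hsub)
  have hlink : ∀ p q, InThread f blk p q → Link G F.blocks (f p).1 (f q).1 := by
    rintro p q ⟨hthr, hpq⟩
    by_cases hle : p ≤ q
    · left
      rw [progOrder_iff]
      rcases hle.eq_or_lt with rfl | hlt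
      · obtain ⟨e, he, hel⟩ := Run.exists_edge (htrace p) (hword p)
        exact ⟨e, he, e, he, hel, hel, .refl⟩
      · have hsub := (hpair p q hlt hthr).map Prod.fst
        rw [numbered_map_fst, hPs] at hsub
        obtain ⟨e, he, e', he', h1, h2, h3⟩ := Run.exists_transGen_of_sublist (htrace q) hsub
        exact ⟨e, he, e', he', h1, h2, h3.to_reflTransGen⟩
    · right
      rw [atRel_iff]
      obtain ⟨B, hB, e, he, e', he', h1, h2, h3⟩ :=
        hsame q p (not_le.1 hle) hthr.symm (hpq.resolve_left hle).symm
      exact ⟨B, hB, e, he, e', he', h1, h2, h3⟩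
  have hwf : WellFounded (Round I f blk) := by
    by_contra hnwf
    obtain ⟨p, q, r, hthr, hblk, hpq, hdel, hrounds⟩ := exists_back_round hnwf
    obtain ⟨s, hchain, hdel'⟩ := exists_chain_of_rounds
      (fun p => Run.exists_edge (htrace p) (hword p)) hlink hrounds
    obtain ⟨B, hB, e, he, e', he', h1, h2, h3⟩ := hsame p q hpq hthr hblk
    exact h ((hasWitness_iff F.blocks_alphabet_subset).2
      ⟨B, hB, e, e', h3, _, _, hchain, h1 ▸ hdel.2.2, h2 ▸ hdel'.2.2⟩)
  obtain ⟨cs, hcov, hcs, hlt⟩ := exists_serialization hmono hwf _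
    (List.pairwise_lt_finRange θ.length)
  rw [hf] at hcov
  refine ⟨_, ⟨cs.filterMap fun c => ((Ps c.1)[c.2]?).map fun p => (p.1, c.1), ?_, ?_⟩, hcov⟩
  · have hcs' : ∀ c, c ∈ cs ↔ c.2 < (Ps c.1).length := by
      rintro ⟨i, k⟩
      rw [hcs]
      constructor
      · rintro ⟨p, -, hp⟩
        obtain ⟨rfl, rfl⟩ := Prod.mk.inj hp
        simpa using (le_of_mem_numbered (hmem p)).2
      · -- Chunks are not empty, so that the number of every chunk occurs.
        intro hk
        have hne := F.ne_nil_of_mem_morphism (hμ _ _ (List.getElem_mem hk))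
        have hc := hchunk i k _ (List.getElem?_eq_getElem hk)
        obtain ⟨p, hp⟩ : ∃ p, p ∈ (List.finRange θ.length).filter
            fun p => chunk f blk p = (i, k) := by
          refine List.exists_mem_of_ne_nil _ fun h0 => hne ?_
          rw [h0] at hc
          simpa using hc.symm
        exact ⟨p, List.mem_finRange p, by simpa using (List.mem_filter.1 hp).2⟩
    intro i
    rw [localTrace_filterMap hcs' hlt]
    rcases houter i with hi | hi
    · exact Or.inl hi
    · exact Or.inr (by rw [hi]; rfl)
  · rw [List.map_flatMap]
    refine mem_prod_of_chunks fun c hc => ?_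
    obtain ⟨p, -, rfl⟩ := (hcs c).1 hc
    have hlt' : blk p < (Ps (f p).2).length := by
      simpa using (le_of_mem_numbered (hmem p)).2
    exact ⟨_, List.getElem?_eq_getElem hlt', hμ _ _ (List.getElem_mem hlt'),
      hchunk _ _ _ (List.getElem?_eq_getElem hlt')⟩

/-- An atomic fusion is sound if and only if there is no witnessing pair of components. -/
theorem sound_iff_not_hasWitness : F.Sound I ↔ ¬ HasWitness G F.blocks I :=
  ⟨fun h h' => not_sound_of_hasWitness h' h, sound_of_not_hasWitness⟩

end AtomicFusion

end ParProg

set_option exponentiation.threshold 1000 in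
theorem mainTheorem3 :
    ∃ p : Polynomial ℕ, ∀ (Loc Act : Type) [DecidableEq Loc] [DecidableEq Act]
      (G : ParProg.CFG Loc Act) (F : ParProg.AtomicFusion G) (I : List (Act × Act)),
      (∀ x ∈ I, x.1 ∈ G.alphabet ∧ x.2 ∈ G.alphabet) →
        ((ParProg.algorithm G F.blocks I).val = true ↔ F.Sound I) ∧
        ((ParProg.algorithm G F.blocks I).val = false ↔ ParProg.HasWitness G F.blocks I) ∧
        (ParProg.algorithm G F.blocks I).steps ≤ p.eval (ParProg.inputSize G F I) := by
  refine ⟨(Polynomial.X + 2) ^ 500, fun Loc Act _ _ G F I _ => ?_⟩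
  have hval := ParProg.algorithm_val_eq_false_iff F.blocks_alphabet_subset (I := I)
  refine ⟨?_, hval, ?_⟩
  · rw [ParProg.AtomicFusion.sound_iff_not_hasWitness, ← hval, Bool.not_eq_false]
  · simpa only [Polynomial.eval_pow, Polynomial.eval_add, Polynomial.eval_X,
      Polynomial.eval_ofNat] using ParProg.algorithm_steps_le G F I
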